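/- **Setting.** Let $0\le m\le n$, $0\le\alpha<s<\beta\le T$, let $A(t)$ be an $n\times n$ real matrix continuous on $[0,T]$, $B_0\in\mathbb R^{m\times n}$, $B_1\in\mathbb R^{(n-m)\times n}$ of rank $m$ and $n-m$, and put $L=\frac{d}{dt}+A$, $L^*=-\frac{d}{dt}+A^T$. Assume that $L\varphi=0$ a.e. on $(0,T)$, $B_0\varphi(0)=0$, $B_1\varphi(T)=0$ has only the trivial solution in $H^1(0,T)^n$. Let $Q_0,Q_1$ ($m\times m$, $(n-m)\times(n-m)$), $Q(t)$ ($l\times l$, continuous on $[\alpha,\beta]$) and $Q_2(t)$ ($n\times n$, continuous on $[0,T]$) be symmetric positive definite, let $H(t)$ be $l\times n$ and continuous on $[\alpha,\beta]$, and let $f_0^{(0)}\in\mathbb R^m$, $f_1^{(0)}\in\mathbb R^{n-m}$, $f^{(0)}\in L^2(0,T)^n$. Let $B_{01}$ be a nondegenerate $m\times m$ submatrix of $B_0$ and $B_{02}$ the submatrix of the remaining columns; $\hat B_0$ is the $(n-m)\times n$ matrix whose columns at the positions of $B_{01}$, $B_{02}$ form $-B_{02}^T(B_{01}^T)^{-1}$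 and the unit matrix, respectively, and $\bar B_0$ is the $m\times n$ matrix whose columns at these positions form $(B_{01}^T)^{-1}$ and $0$. The matrices $\hat B_1$ ($m\times n$) and $\bar B_1$ ($(n-m)\times n$) are obtained from $B_1$ in the same way. Let $G$ be the set of $F=(f_0,f_1,f)\in\mathbb R^m\times\mathbb R^{n-m}\times L^2(0,T)^n$ with $$(Q_0(f_0-f_0^{(0)}),f_0-f_0^{(0)})+(Q_1(f_1-f_1^{(0)}),f_1-f_1^{(0)})+\int_0^T(Q_2(f-f^{(0)}),f-f^{(0)})\,dt\le1 ,$$ and let $V$ be the set of jointly measurable $\mathbb R^l$-valued processes $\xi(t)$, $t\in(\alpha,\beta)$, on a probability space that carries a random variable of mean $0$ and variance $1$, with zero mean and finite second moments, $M|\xi(t)|^2$ integrable on $(\alpha,\beta)$, and $\int_\alpha^\beta \mathrm{Sp}[Q(t)R(t,t)]\,dt\le1$, $R(t,t')=M\xi(t)\xi^T(t')$. For $F\in G$ let $\varphi\in H^1(0,T)^n$ be the solution of $L\varphi=f$ a.e. on $(0,T)$, $B_0\varphi(0)=f_0$, $B_1\varphi(T)=f_1$, and for $\xi\in V$ let $y(t)=H(t)\varphi(t)+\xi(t)$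 be observed on $(\alpha,\beta)$. A *minimax estimate* of $(a,\varphi(s))$, $a\in\mathbb R^n$, is an expression $\int_\alpha^s(u_1,y)\,dt+\int_s^\beta(u_2,y)\,dt+c$ for which $(u_1,u_2,c)\in L^2(\alpha,s)^l\times L^2(s,\beta)^l\times\mathbb R$ minimizes $$\sigma(u,c)=\sup_{F\in G,\ \xi\in V}M\Big|(a,\varphi(s))-\int_\alpha^s(u_1,y)\,dt-\int_s^\beta(u_2,y)\,dt-c\Big|^2 .$$ **Theorem.** (i) For every $y\in L^2(\alpha,\beta)^l$ there is exactly one solution $\hat p_1,\hat\varphi_1\in H^1(0,\alpha)^n$, $\hat p_2,\hat\varphi_2\in H^1(\alpha,s)^n$, $\hat p_3,\hat\varphi_3\in H^1(s,\beta)^n$, $\hat p_4,\hat\varphi_4\in H^1(\beta,T)^n$ of the system $$\begin{aligned} &L^*\hat p_1=0 \text{ on }(0,\alpha),\quad \hat B_0\hat p_1(0)=0,\\ &L^*\hat p_2=H^TQ(y-H\hat\varphi_2)\text{ on }(\alpha,s),\quad \hat p_2(\alpha)=\hat p_1(\alpha),\\ &L^*\hat p_3=H^TQ(y-H\hat\varphi_3)\text{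 on }(s,\beta),\quad \hat p_3(s)=\hat p_2(s),\\ &L^*\hat p_4=0\text{ on }(\beta,T),\quad \hat p_4(\beta)=\hat p_3(\beta),\quad \hat B_1\hat p_4(T)=0,\\ &L\hat\varphi_1=Q_2^{-1}\hat p_1+f^{(0)}\text{ on }(0,\alpha),\quad B_0\hat\varphi_1(0)=Q_0^{-1}\bar B_0\hat p_1(0)+f_0^{(0)},\\ &L\hat\varphi_2=Q_2^{-1}\hat p_2+f^{(0)}\text{ on }(\alpha,s),\quad \hat\varphi_2(\alpha)=\hat\varphi_1(\alpha),\\ &L\hat\varphi_3=Q_2^{-1}\hat p_3+f^{(0)}\text{ on }(s,\beta),\quad \hat\varphi_3(s)=\hat\varphi_2(s),\\ &L\hat\varphi_4=Q_2^{-1}\hat p_4+f^{(0)}\text{ on }(\beta,T),\quad \hat\varphi_4(\beta)=\hat\varphi_3(\beta),\quad B_1\hat\varphi_4(T)=-Q_1^{-1}\bar B_1\hat p_4(T)+f_1^{(0)}, \end{aligned}$$ the equations holding almost everywhere. (ii) For all $F\in G$ and $\xi\in V$, almost every realization of $y=H\varphi+\xi$ belongs to $L^2(\alpha,\beta)^l$.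 (iii) For every $a\in\mathbb R^n$ a minimax estimate of $(a,\varphi(s))$ exists, and every minimax estimate equals $(a,\hat\varphi_2(s))$ at every realization $y\in L^2(\alpha,\beta)^l$, where $\hat\varphi_2$ is taken from the system in (i), which does not involve $a$. (iv) Consequently $\hat\varphi_2(s)$, as a function of $y$ that does not depend on $a$, is an estimate of the vector $\varphi(s)$: for every $a$, the worst-case error $\sup_{F\in G,\,\xi\in V}M|(a,\varphi(s))-(a,\hat\varphi_2(s))|^2$ equals $\inf_{u,c}\sigma(u,c)$. -/

import Mathlib

open MeasureTheory Set
open scoped ENNReal Matrix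

noncomputable section

namespace BVPEstimation

/-! ### Boundary matrices

`e : p ⊕ q ≃ ν` is a choice of columns: the columns `e (inl k)` of `B` form the square block, the
columns `e (inr k)` are the remaining ones. -/

section Boundary

variable {p q ν : Type*} [Fintype p] [DecidableEq p] [DecidableEq q]

/-- The square submatrix of `B` formed by the selected columns. -/
def selBlock (e : p ⊕ q ≃ ν) (B : Matrix p ν ℝ) : Matrix p p ℝ :=
  B.submatrix id (fun k => e (Sum.inl k))

/-- The submatrix of `B` formed by the remaining columns. -/
def restBlock (e : p ⊕ q ≃ ν) (B : Matrix p ν ℝ) : Matrix p q ℝ :=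
  B.submatrix id (fun k => e (Sum.inr k))

/-- `B̂ = (-B₂ᵀ (B₁ᵀ)⁻¹, E)`, with `B₁` the selected and `B₂` the remaining block; the columns
are put back at the positions they have in `B`. -/
def hatMat (e : p ⊕ q ≃ ν) (B : Matrix p ν ℝ) : Matrix q ν ℝ :=
  (Matrix.fromCols (-((restBlock e B)ᵀ * ((selBlock e B)ᵀ)⁻¹)) (1 : Matrix q q ℝ)).submatrix
    id e.symm

/-- `B̄ = ((B₁ᵀ)⁻¹, 0)`, columns at the positions they have in `B`. -/
def barMat (e : p ⊕ q ≃ ν) (B : Matrix p ν ℝ) : Matrix p ν ℝ :=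
  (Matrix.fromCols (((selBlock e B)ᵀ)⁻¹) (0 : Matrix p q ℝ)).submatrix id e.symm

end Boundary

/-! ### Sobolev functions and the differential operators -/

/-- `x ∈ H¹(a, b)ⁿ`: every component is absolutely continuous on `[a, b]` with derivative in
`L²(a, b)`. -/
def IsH1 {n : ℕ} (a b : ℝ) (x : ℝ → Fin n → ℝ) : Prop :=
  ∀ i, AbsolutelyContinuousOnInterval (fun t => x t i) a b ∧
    MemLp (deriv fun t => x t i) 2 (volume.restrict (Ioo a b))

/-- `x ∈ L²(a, b)ᵏ`. -/
def IsL2 {k : ℕ} (a b : ℝ) (x : ℝ → Fin k → ℝ) : Prop :=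
  MemLp x 2 (volume.restrict (Ioo a b))

/-- `L x = dx/dt + A x`. -/
def opL {n : ℕ} (A : ℝ → Matrix (Fin n) (Fin n) ℝ) (x : ℝ → Fin n → ℝ) (t : ℝ) : Fin n → ℝ :=
  fun i => deriv (fun τ => x τ i) t + (A t *ᵥ x t) i

/-- `L* x = -dx/dt + Aᵀ x`. -/
def opLstar {n : ℕ} (A : ℝ → Matrix (Fin n) (Fin n) ℝ) (x : ℝ → Fin n → ℝ) (t : ℝ) :
    Fin n → ℝ :=
  fun i => -deriv (fun τ => x τ i) t + ((A t)ᵀ *ᵥ x t) i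

/-- `x ∈ H¹(a, b)ⁿ` and `L x = g` almost everywhere on `(a, b)`. -/
def SolvesL {n : ℕ} (A : ℝ → Matrix (Fin n) (Fin n) ℝ) (a b : ℝ) (x g : ℝ → Fin n → ℝ) : Prop :=
  IsH1 a b x ∧ ∀ᵐ t ∂volume.restrict (Ioo a b), opL A x t = g t

/-- `x ∈ H¹(a, b)ⁿ` and `L* x = g` almost everywhere on `(a, b)`. -/
def SolvesLstar {n : ℕ} (A : ℝ → Matrix (Fin n) (Fin n) ℝ) (a b : ℝ) (x g : ℝ → Fin n → ℝ) :
    Prop :=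
  IsH1 a b x ∧ ∀ᵐ t ∂volume.restrict (Ioo a b), opLstar A x t = g t

/-! ### The estimation problem -/

/-- Right-hand sides `(f₀, f₁, f)` of the boundary value problem. -/
structure Rhs (n m : ℕ) where
  f₀ : Fin m → ℝ
  f₁ : Fin (n - m) → ℝ
  f : ℝ → Fin n → ℝ

/-- The data of the estimation problem (no assumptions yet). -/
structure Problem (n m l : ℕ) where
  /-- the differential equation lives on `(0, T)` -/
  T : ℝ
  /-- left end of the observation interval -/
  α : ℝ
  /-- right end of the observation interval -/
  β : ℝ
  /-- the point at which the state is estimated -/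
  s : ℝ
  A : ℝ → Matrix (Fin n) (Fin n) ℝ
  B₀ : Matrix (Fin m) (Fin n) ℝ
  B₁ : Matrix (Fin (n - m)) (Fin n) ℝ
  H : ℝ → Matrix (Fin l) (Fin n) ℝ
  /-- weight of the noise -/
  Q : ℝ → Matrix (Fin l) (Fin l) ℝ
  Q₀ : Matrix (Fin m) (Fin m) ℝ
  Q₁ : Matrix (Fin (n - m)) (Fin (n - m)) ℝ
  Q₂ : ℝ → Matrix (Fin n) (Fin n) ℝ
  /-- centre `(f₀⁰, f₁⁰, f⁰)` of the set of admissible right-hand sides -/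
  centre : Rhs n m

namespace Problem

variable {n m l : ℕ} (S : Problem n m l)

/-- `φ ∈ H¹(0, T)ⁿ` solves `L φ = f` a.e. on `(0, T)`, `B₀ φ(0) = f₀`, `B₁ φ(T) = f₁`. -/
def SolvesBVP (F : Rhs n m) (φ : ℝ → Fin n → ℝ) : Prop :=
  SolvesL S.A 0 S.T φ F.f ∧ S.B₀ *ᵥ φ 0 = F.f₀ ∧ S.B₁ *ᵥ φ S.T = F.f₁

/-- Standing assumptions. Positive definite matrices are symmetric. -/
structure Standing : Prop where
  m_le : m ≤ n
  zero_le_α : 0 ≤ S.α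
  α_lt_s : S.α < S.s
  s_lt_β : S.s < S.β
  β_le_T : S.β ≤ S.T
  A_cont : ContinuousOn S.A (Icc 0 S.T)
  H_cont : ContinuousOn S.H (Icc S.α S.β)
  B₀_rank : S.B₀.rank = m
  B₁_rank : S.B₁.rank = n - m
  Q_posDef : ∀ t ∈ Icc S.α S.β, (S.Q t).PosDef
  Q_cont : ContinuousOn S.Q (Icc S.α S.β)
  Q₀_posDef : S.Q₀.PosDef
  Q₁_posDef : S.Q₁.PosDef
  Q₂_posDef : ∀ t ∈ Icc 0 S.T, (S.Q₂ t).PosDef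
  Q₂_cont : ContinuousOn S.Q₂ (Icc 0 S.T)
  centre_L2 : IsL2 0 S.T S.centre.f
  /-- the homogeneous boundary value problem has only the trivial solution -/
  homogeneous : ∀ φ, S.SolvesBVP ⟨0, 0, 0⟩ φ → ∀ t ∈ Icc 0 S.T, φ t = 0

/-- The set `G` of admissible right-hand sides: an ellipsoid around the centre. -/
def G : Set (Rhs n m) :=
  {F | IsL2 0 S.T F.f ∧
    (S.Q₀ *ᵥ (F.f₀ - S.centre.f₀)) ⬝ᵥ (F.f₀ - S.centre.f₀)
      + (S.Q₁ *ᵥ (F.f₁ - S.centre.f₁)) ⬝ᵥ (F.f₁ - S.centre.f₁)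
      + (∫ t in (0 : ℝ)..S.T,
          (S.Q₂ t *ᵥ (F.f t - S.centre.f t)) ⬝ᵥ (F.f t - S.centre.f t)) ≤ 1}

section Random

variable {Ω : Type*} [MeasurableSpace Ω] (P : Measure Ω)

/-- Correlation matrix `R(t, t') = M ξ(t) ξ(t')ᵀ`. -/
def corr (ξ : ℝ → Ω → Fin l → ℝ) (t t' : ℝ) : Matrix (Fin l) (Fin l) ℝ :=
  Matrix.of fun i j => ∫ ω, ξ t ω i * ξ t' ω j ∂P

/-- The set `V` of admissible noises: (jointly measurable) processes on `(α, β)` with zero mean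
and finite second moments that are integrable over `(α, β)`, such that
`∫ Sp [Q(t) R(t, t)] dt ≤ 1`. -/
structure IsNoise (ξ : ℝ → Ω → Fin l → ℝ) : Prop where
  aesm : AEStronglyMeasurable (fun z : ℝ × Ω => ξ z.1 z.2)
    ((volume.restrict (Ioo S.α S.β)).prod P)
  memLp : ∀ t ∈ Ioo S.α S.β, MemLp (ξ t) 2 P
  mean : ∀ t ∈ Ioo S.α S.β, ∀ i, ∫ ω, ξ t ω i ∂P = 0
  second : IntegrableOn (fun t => ∫ ω, ξ t ω ⬝ᵥ ξ t ω ∂P) (Ioo S.α S.β)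
  trace_le : ∫ t in S.α..S.β, (S.Q t * corr P ξ t t).trace ≤ 1

/-- Realization `y(·, ω) = H φ + ξ(·, ω)` of the observations. -/
def obs (φ : ℝ → Fin n → ℝ) (ξ : ℝ → Ω → Fin l → ℝ) (ω : Ω) : ℝ → Fin l → ℝ :=
  fun t => S.H t *ᵥ φ t + ξ t ω

/-- Worst-case mean square error of the estimate `est y` of `(a, φ(s))`, the supremum being taken
over all right-hand sides in `G` and all noises in `V`. -/
def worstRisk (a : Fin n → ℝ) (est : (ℝ → Fin l → ℝ) → ℝ) : ℝ≥0∞ :=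
  ⨆ (F : Rhs n m) (_ : F ∈ S.G) (φ : ℝ → Fin n → ℝ) (_ : S.SolvesBVP F φ)
    (ξ : ℝ → Ω → Fin l → ℝ) (_ : S.IsNoise P ξ),
    ∫⁻ ω, ENNReal.ofReal ((a ⬝ᵥ φ S.s - est (S.obs φ ξ ω)) ^ 2) ∂P

/-- The estimate `∫_α^s (u₁, y) dt + ∫_s^β (u₂, y) dt + c`, linear in the observations. -/
def linEst (u₁ u₂ : ℝ → Fin l → ℝ) (c : ℝ) (y : ℝ → Fin l → ℝ) : ℝ :=
  (∫ t in S.α..S.s, u₁ t ⬝ᵥ y t) + (∫ t in S.s..S.β, u₂ t ⬝ᵥ y t) + c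

/-- `(u₁, u₂, c)` yields a minimax estimate of `(a, φ(s))`: it minimizes the worst-case mean square
error over `u₁ ∈ L²(α, s)`, `u₂ ∈ L²(s, β)`, `c ∈ ℝ`. -/
def IsMinimax (a : Fin n → ℝ) (u₁ u₂ : ℝ → Fin l → ℝ) (c : ℝ) : Prop :=
  IsL2 S.α S.s u₁ ∧ IsL2 S.s S.β u₂ ∧
    ∀ (v₁ v₂ : ℝ → Fin l → ℝ) (d : ℝ), IsL2 S.α S.s v₁ → IsL2 S.s S.β v₂ →
      S.worstRisk P a (S.linEst u₁ u₂ c) ≤ S.worstRisk P a (S.linEst v₁ v₂ d)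

end Random

/-- The system for `(p̂ᵢ, φ̂ᵢ)`, `i = 1, …, 4`, driven by the observation `y`; the four functions
`p̂₁, …, p̂₄` are `p 0, …, p 3`, living on `[0, α]`, `[α, s]`, `[s, β]`, `[β, T]`, and the same for
`φ̂`. The column choices `e₀`, `e₁` define the matrices `B̂₀, B̄₀, B̂₁, B̄₁`. -/
structure SolvesSystem (e₀ : Fin m ⊕ Fin (n - m) ≃ Fin n) (e₁ : Fin (n - m) ⊕ Fin m ≃ Fin n)
    (y : ℝ → Fin l → ℝ) (p φ : Fin 4 → ℝ → Fin n → ℝ) : Prop where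
  p₁ : SolvesLstar S.A 0 S.α (p 0) 0
  p₂ : SolvesLstar S.A S.α S.s (p 1)
    fun t => ((S.H t)ᵀ * S.Q t) *ᵥ (y t - S.H t *ᵥ φ 1 t)
  p₃ : SolvesLstar S.A S.s S.β (p 2)
    fun t => ((S.H t)ᵀ * S.Q t) *ᵥ (y t - S.H t *ᵥ φ 2 t)
  p₄ : SolvesLstar S.A S.β S.T (p 3) 0
  p_zero : hatMat e₀ S.B₀ *ᵥ p 0 0 = 0
  p_α : p 1 S.α = p 0 S.α
  p_s : p 2 S.s = p 1 S.s
  p_β : p 3 S.β = p 2 S.β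
  p_T : hatMat e₁ S.B₁ *ᵥ p 3 S.T = 0
  φ₁ : SolvesL S.A 0 S.α (φ 0) fun t => (S.Q₂ t)⁻¹ *ᵥ p 0 t + S.centre.f t
  φ₂ : SolvesL S.A S.α S.s (φ 1) fun t => (S.Q₂ t)⁻¹ *ᵥ p 1 t + S.centre.f t
  φ₃ : SolvesL S.A S.s S.β (φ 2) fun t => (S.Q₂ t)⁻¹ *ᵥ p 2 t + S.centre.f t
  φ₄ : SolvesL S.A S.β S.T (φ 3) fun t => (S.Q₂ t)⁻¹ *ᵥ p 3 t + S.centre.f t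
  φ_zero : S.B₀ *ᵥ φ 0 0 = S.Q₀⁻¹ *ᵥ (barMat e₀ S.B₀ *ᵥ p 0 0) + S.centre.f₀
  φ_α : φ 1 S.α = φ 0 S.α
  φ_s : φ 2 S.s = φ 1 S.s
  φ_β : φ 3 S.β = φ 2 S.β
  φ_T : S.B₁ *ᵥ φ 3 S.T = -(S.Q₁⁻¹ *ᵥ (barMat e₁ S.B₁ *ᵥ p 3 S.T)) + S.centre.f₁

/-- Two quadruples of functions on `[0, α]`, `[α, s]`, `[s, β]`, `[β, T]` coincide. -/
def SamePieces (x x' : Fin 4 → ℝ → Fin n → ℝ) : Prop :=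
  EqOn (x 0) (x' 0) (Icc 0 S.α) ∧ EqOn (x 1) (x' 1) (Icc S.α S.s) ∧
    EqOn (x 2) (x' 2) (Icc S.s S.β) ∧ EqOn (x 3) (x' 3) (Icc S.β S.T)

end Problem

end BVPEstimation

end

namespace BVPEstimation

/-! ### Square integrable functions on an interval -/

section SquareIntegrable

variable {k n : ℕ} {a b c d : ℝ}

/-! The error of a linear estimate with coefficient `u` and constant `c` is a deterministic bias
minus a centred noise term, so its mean square is (bias − c)² plus a variance. The supremum of the
variance over the noises is ∫(Q⁻¹u, u) (`coeffForm`): Cauchy–Schwarz gives the bound and a rank-one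
noise along Q⁻¹u attains it. The bias is an affine functional of the right-hand side F, and G is the
unit ball of a quadratic form (`form`) around the centre.

The optimal coefficient is û = QHψ. Here ψ belongs to a coupled state–adjoint system whose adjoint
component jumps by the vector a at s, and Lagrange's identity shows that the data D of ψ represent
the functional (a, φ(s)) − ∫(û, Hφ) in the form of the ellipsoid (`exists_represents`). Taking for c
the bias at the solution for the centre, the worst risk is at most form(D, D) + ∫(Q⁻¹û, û)
(`Represents.worstRisk_le`).

For the lower bound, any other u is tested on right-hand sides centre ± rD together with its own
worst noise. With the right r the cross terms in u − û cancel between bias and variance or are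
dominated, and the risk exceeds the value above by at least ∫(Q⁻¹(u − û), u − û) plus the squared
error of the constant (`Represents.le_worstRisk`). This proves optimality, and it also shows that
any minimizer agrees with û almost everywhere and has the same constant.

Pairing ψ with the adjoint component of the system driven by y identifies the optimal estimate with
(a, φ̂₂(s)) (`Represents.eval_system`); a enters only through ψ, so one vector φ̂₂(s) serves all a.

All systems involved are solved by a Fredholm alternative for two-point problems
(`exists_boundaryValue_solution`), which reduces existence to uniqueness. For the coupled system
uniqueness is an energy identity: a vanishing sum of nonnegative terms forces the adjoint to vanish,
and then the assumption on the homogeneous problem applies (`SolvesGlobal.eq_zero`). -/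

theorem continuousOn_entry {p q : Type*} {M : ℝ → Matrix p q ℝ} {s : Set ℝ}
    (hM : ContinuousOn M s) (i : p) (j : q) : ContinuousOn (fun t => M t i j) s :=
  (continuous_apply_apply i j).comp_continuousOn hM

theorem ContinuousOn.memLp_Ioo {E : Type*} [NormedAddCommGroup E] {f : ℝ → E}
    (hf : ContinuousOn f (Icc a b)) (p : ℝ≥0∞) : MemLp f p (volume.restrict (Ioo a b)) := by
  obtain ⟨C, hC⟩ := isCompact_Icc.exists_bound_of_continuousOn hf
  refine (MemLp.of_bound (hf.aestronglyMeasurable_of_isCompact isCompact_Icc measurableSet_Icc) C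
    ?_).mono_measure (Measure.restrict_mono Ioo_subset_Icc_self le_rfl)
  exact (ae_restrict_iff' measurableSet_Icc).2 (Filter.Eventually.of_forall hC)

theorem isL2_iff {x : ℝ → Fin k → ℝ} :
    IsL2 a b x ↔ ∀ i, MemLp (fun t => x t i) 2 (volume.restrict (Ioo a b)) :=
  memLp_pi_iff

theorem memLp_continuousOn_mul {f g : ℝ → ℝ} (hf : ContinuousOn f (Icc a b))
    (hg : MemLp g 2 (volume.restrict (Ioo a b))) :
    MemLp (fun t => f t * g t) 2 (volume.restrict (Ioo a b)) :=
  MemLp.mul (p := ∞) (q := 2) hg (ContinuousOn.memLp_Ioo hf ∞)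

theorem IsL2.mulVec {M : ℝ → Matrix (Fin k) (Fin n) ℝ} {x : ℝ → Fin n → ℝ}
    (hM : ContinuousOn M (Icc a b)) (hx : IsL2 a b x) : IsL2 a b fun t => M t *ᵥ x t := by
  rw [isL2_iff] at hx ⊢
  intro i
  simp only [Matrix.mulVec, dotProduct]
  exact memLp_finsetSum _ fun j _ => memLp_continuousOn_mul (continuousOn_entry hM i j) (hx j)

theorem IsL2.add_smul {x y : ℝ → Fin k → ℝ} (hx : IsL2 a b x) (r : ℝ) (hy : IsL2 a b y) :
    IsL2 a b fun t => x t + r • y t :=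
  MemLp.add hx (MemLp.const_smul hy r)

theorem IsL2.add {x y : ℝ → Fin k → ℝ} (hx : IsL2 a b x) (hy : IsL2 a b y) :
    IsL2 a b fun t => x t + y t :=
  MemLp.add hx hy

theorem IsL2.sub {x y : ℝ → Fin k → ℝ} (hx : IsL2 a b x) (hy : IsL2 a b y) :
    IsL2 a b fun t => x t - y t :=
  MemLp.sub hx hy

theorem IsL2.mono {x : ℝ → Fin k → ℝ} (hx : IsL2 a b x) (hac : a ≤ c) (hdb : d ≤ b) :
    IsL2 c d x :=
  MemLp.mono_measure (Measure.restrict_mono (Ioo_subset_Ioo hac hdb) le_rfl) hx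

theorem IsL2.congr {x y : ℝ → Fin k → ℝ} (hx : IsL2 a b x)
    (h : ∀ᵐ t ∂volume.restrict (Ioo a b), x t = y t) : IsL2 a b y :=
  (memLp_congr_ae h).1 hx

theorem ContinuousOn.isL2 {x : ℝ → Fin k → ℝ} (hx : ContinuousOn x (Icc a b)) : IsL2 a b x :=
  ContinuousOn.memLp_Ioo hx 2

theorem intervalIntegrable_iff_Ioo {E : Type*} [NormedAddCommGroup E] {f : ℝ → E} (hab : a ≤ b) :
    IntervalIntegrable f volume a b ↔ Integrable f (volume.restrict (Ioo a b)) := by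
  rw [intervalIntegrable_iff_integrableOn_Ioc_of_le hab, integrableOn_Ioc_iff_integrableOn_Ioo]
  rfl

theorem intervalIntegral_eq_Ioo {E : Type*} [NormedAddCommGroup E] [NormedSpace ℝ E] {f : ℝ → E}
    (hab : a ≤ b) : ∫ t in a..b, f t = ∫ t in Ioo a b, f t := by
  rw [intervalIntegral.integral_of_le hab, integral_Ioc_eq_integral_Ioo]

theorem MemLp.intervalIntegrable {f : ℝ → ℝ} (hab : a ≤ b)
    (hf : MemLp f 2 (volume.restrict (Ioo a b))) : IntervalIntegrable f volume a b :=
  (intervalIntegrable_iff_Ioo hab).2 (hf.integrable (by norm_num))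

theorem IsL2.integrable_dotProduct {x y : ℝ → Fin k → ℝ} (hx : IsL2 a b x) (hy : IsL2 a b y) :
    Integrable (fun t => x t ⬝ᵥ y t) (volume.restrict (Ioo a b)) := by
  rw [isL2_iff] at hx hy
  simp only [dotProduct]
  exact integrable_finsetSum _ fun i _ => (hx i).integrable_mul (hy i)

theorem IsL2.intervalIntegrable_dotProduct {x y : ℝ → Fin k → ℝ} (hab : a ≤ b) (hx : IsL2 a b x)
    (hy : IsL2 a b y) : IntervalIntegrable (fun t => x t ⬝ᵥ y t) volume a b :=
  (intervalIntegrable_iff_Ioo hab).2 (hx.integrable_dotProduct hy)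

theorem intervalIntegral_congr_Ioo {E : Type*} [NormedAddCommGroup E] [NormedSpace ℝ E]
    {f g : ℝ → E} (hab : a ≤ b) (h : ∀ᵐ t ∂volume.restrict (Ioo a b), f t = g t) :
    ∫ t in a..b, f t = ∫ t in a..b, g t := by
  rw [intervalIntegral_eq_Ioo hab, intervalIntegral_eq_Ioo hab]
  exact integral_congr_ae h

end SquareIntegrable

/-! ### The operator `L` -/

section Operator

variable {n : ℕ} {A : ℝ → Matrix (Fin n) (Fin n) ℝ} {a b c d : ℝ} {x y g h : ℝ → Fin n → ℝ}

theorem IsH1.continuousOn (hx : IsH1 a b x) (hab : a ≤ b) : ContinuousOn x (Icc a b) := by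
  rw [← uIcc_of_le hab]
  exact continuousOn_pi.2 fun i => (hx i).1.continuousOn

theorem IsH1.mono (hx : IsH1 a b x) (hac : a ≤ c) (hcd : c ≤ d) (hdb : d ≤ b) : IsH1 c d x := by
  refine fun i => ⟨(hx i).1.mono ?_, (hx i).2.mono_measure
    (Measure.restrict_mono (Ioo_subset_Ioo hac hdb) le_rfl)⟩
  rw [uIcc_of_le hcd, uIcc_of_le (hac.trans (hcd.trans hdb))]
  exact Icc_subset_Icc hac hdb

theorem SolvesL.mono (hx : SolvesL A a b x g) (hac : a ≤ c) (hcd : c ≤ d) (hdb : d ≤ b) :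
    SolvesL A c d x g :=
  ⟨hx.1.mono hac hcd hdb,
    ae_mono (Measure.restrict_mono (Ioo_subset_Ioo hac hdb) le_rfl) hx.2⟩

theorem SolvesL.congr_rhs (hx : SolvesL A a b x g)
    (hgh : ∀ᵐ t ∂volume.restrict (Ioo a b), g t = h t) : SolvesL A a b x h :=
  ⟨hx.1, by filter_upwards [hx.2, hgh] with t h1 h2 using h1.trans h2⟩

theorem ae_restrict_of_forall_mem_Ioo {P : ℝ → Prop} (hP : ∀ t ∈ Ioo a b, P t) :
    ∀ᵐ t ∂volume.restrict (Ioo a b), P t :=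
  (ae_restrict_iff' measurableSet_Ioo).2 (Filter.Eventually.of_forall hP)

theorem deriv_congr_Ioo {f f' : ℝ → ℝ} (hf : EqOn f f' (Ioo a b)) {t : ℝ} (ht : t ∈ Ioo a b) :
    deriv f t = deriv f' t :=
  Filter.EventuallyEq.deriv_eq (Filter.eventuallyEq_of_mem (Ioo_mem_nhds ht.1 ht.2) hf)

theorem absolutelyContinuousOnInterval_congr {f f' : ℝ → ℝ} (hff' : EqOn f f' (uIcc a b))
    (hf : AbsolutelyContinuousOnInterval f a b) : AbsolutelyContinuousOnInterval f' a b := by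
  rw [absolutelyContinuousOnInterval_iff] at hf ⊢
  intro ε hε
  obtain ⟨δ, hδ, H⟩ := hf ε hε
  refine ⟨δ, hδ, fun E hE hlt => ?_⟩
  have := H E hE hlt
  convert this using 2 with i hi
  have h1 := hE.1 i hi
  rw [hff' h1.1, hff' h1.2]

theorem SolvesL.congr (hx : SolvesL A a b x g) (hab : a ≤ b) (hxy : EqOn x y (Icc a b)) :
    SolvesL A a b y g := by
  have hc : ∀ i, EqOn (fun t => x t i) (fun t => y t i) (Icc a b) := fun i t ht => by
    simp only [hxy ht]
  have hd : ∀ i, ∀ t ∈ Ioo a b, deriv (fun τ => x τ i) t = deriv (fun τ => y τ i) t :=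
    fun i t ht => deriv_congr_Ioo ((hc i).mono Ioo_subset_Icc_self) ht
  refine ⟨fun i => ⟨absolutelyContinuousOnInterval_congr (by rw [uIcc_of_le hab]; exact hc i)
    (hx.1 i).1, ?_⟩, ?_⟩
  · exact (memLp_congr_ae (ae_restrict_of_forall_mem_Ioo (hd i))).1 (hx.1 i).2
  · filter_upwards [hx.2, ae_restrict_of_forall_mem_Ioo (fun t ht => ht)] with t h1 ht
    rw [← h1]
    ext i
    simp only [opL]
    rw [hd i t ht, hxy (Ioo_subset_Icc_self ht)]

theorem SolvesL.add_smul (hab : a ≤ b) (hx : SolvesL A a b x g) (r : ℝ)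
    (hy : SolvesL A a b y h) :
    SolvesL A a b (fun t => x t + r • y t) (fun t => g t + r • h t) := by
  have key : ∀ i, ∀ᵐ t ∂volume.restrict (Ioo a b),
      deriv (fun τ => (x τ + r • y τ) i) t
        = deriv (fun τ => x τ i) t + r * deriv (fun τ => y τ i) t := by
    intro i
    filter_upwards [ae_restrict_of_ae (hx.1 i).1.ae_differentiableAt,
      ae_restrict_of_ae (hy.1 i).1.ae_differentiableAt,
      ae_restrict_of_forall_mem_Ioo (fun t ht => ht)] with t h1 h2 ht
    have ht' : t ∈ uIcc a b := by rw [uIcc_of_le hab]; exact Ioo_subset_Icc_self ht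
    have := ((h1 ht').hasDerivAt.add ((h2 ht').hasDerivAt.const_mul r)).deriv
    simpa [Pi.add_def] using this
  refine ⟨fun i => ⟨(hx.1 i).1.add ((hy.1 i).1.const_mul r), ?_⟩, ?_⟩
  · exact (memLp_congr_ae (key i)).2 ((hx.1 i).2.add ((hy.1 i).2.const_mul r))
  · filter_upwards [hx.2, hy.2, ae_all_iff.2 key] with t h1 h2 h3
    rw [← h1, ← h2]
    ext i
    have h4 := h3 i
    simp only [opL, Matrix.mulVec_add, Matrix.mulVec_smul, Pi.add_apply, Pi.smul_apply,
      smul_eq_mul] at h4 ⊢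
    rw [h4]
    ring

theorem SolvesL.sub (hab : a ≤ b) (hx : SolvesL A a b x g) (hy : SolvesL A a b y h) :
    SolvesL A a b (fun t => x t - y t) (fun t => g t - h t) := by
  simpa [sub_eq_add_neg] using hx.add_smul hab (-1) hy

theorem SolvesL.integral_eq (hx : SolvesL A a b x g) {t : ℝ} (ht : t ∈ Icc a b)
    (i : Fin n) : x t i = x a i + ∫ τ in a..t, (g τ - A τ *ᵥ x τ) i := by
  have h1 := ((hx.mono le_rfl ht.1 ht.2).1 i).1.integral_deriv_eq_sub
  rw [eq_comm, ← eq_sub_iff_add_eq', ← h1]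
  refine intervalIntegral_congr_Ioo ht.1 ?_
  filter_upwards [(hx.mono le_rfl ht.1 ht.2).2] with τ hτ
  rw [← hτ]
  simp [opL]

theorem SolvesL.isL2 (hab : a ≤ b) (hA : ContinuousOn A (Icc a b)) (hx : SolvesL A a b x g) :
    IsL2 a b g := by
  refine IsL2.congr ?_ hx.2
  have h1 : IsL2 a b fun t i => deriv (fun τ => x τ i) t := isL2_iff.2 fun i => (hx.1 i).2
  exact h1.add ((ContinuousOn.isL2 (hx.1.continuousOn hab)).mulVec hA)

/-- Lebesgue differentiation of the primitive. This is the way back from Volterra integral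
equations, where existence is proved, to Sobolev solutions. -/
theorem isH1_of_integral {k : ℝ → Fin n → ℝ} (hab : a ≤ b) (hk : IsL2 a b k)
    (hx : ∀ t ∈ Icc a b, ∀ i, x t i = x a i + ∫ τ in a..t, k τ i) :
    IsH1 a b x ∧ ∀ᵐ t ∂volume.restrict (Ioo a b), ∀ i, deriv (fun τ => x τ i) t = k t i := by
  rw [isL2_iff] at hk
  have hint : ∀ i, IntervalIntegrable (fun t => k t i) volume a b :=
    fun i => MemLp.intervalIntegrable hab (hk i)
  have hd : ∀ᵐ t ∂volume.restrict (Ioo a b), ∀ i, deriv (fun τ => x τ i) t = k t i := by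
    refine ae_all_iff.2 fun i => ?_
    filter_upwards [ae_restrict_of_ae (hint i).ae_hasDerivAt_integral,
      ae_restrict_of_forall_mem_Ioo (fun t ht => ht)] with t h1 ht
    rw [uIcc_of_le hab] at h1
    have h2 := h1 (Ioo_subset_Icc_self ht) a (left_mem_Icc.2 hab)
    rw [deriv_congr_Ioo (f' := fun τ => x a i + ∫ v in a..τ, k v i) (a := a) (b := b) _ ht]
    · exact (h2.const_add (x a i)).deriv
    · exact fun τ hτ => hx τ (Ioo_subset_Icc_self hτ) i
  refine ⟨fun i => ⟨?_, ?_⟩, hd⟩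
  · have h1 := (hint i).absolutelyContinuousOnInterval_intervalIntegral left_mem_uIcc
    have h2 : AbsolutelyContinuousOnInterval (fun _ : ℝ => x a i) a b :=
      (LipschitzWith.const (x a i)).lipschitzOnWith.absolutelyContinuousOnInterval
    refine absolutelyContinuousOnInterval_congr ?_ (h2.add h1)
    rw [uIcc_of_le hab]
    exact fun t ht => (hx t ht i).symm
  · refine (memLp_congr_ae ?_).1 (hk i)
    filter_upwards [hd] with t ht using (ht i).symm

theorem solvesL_of_integral (hab : a ≤ b) (hA : ContinuousOn A (Icc a b)) (hg : IsL2 a b g)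
    (hxc : ContinuousOn x (Icc a b))
    (hx : ∀ t ∈ Icc a b, ∀ i, x t i = x a i + ∫ τ in a..t, (g τ - A τ *ᵥ x τ) i) :
    SolvesL A a b x g := by
  obtain ⟨h1, h2⟩ := isH1_of_integral hab (hg.sub ((ContinuousOn.isL2 hxc).mulVec hA)) hx
  refine ⟨h1, ?_⟩
  filter_upwards [h2] with t ht
  ext i
  simp [opL, ht i]

/-- No matching condition appears because one function `x` solves on both sides and is continuous at
`b`; the two integral equations then add up. -/
theorem SolvesL.glue (hab : a ≤ b) (hbc : b ≤ c) (hA : ContinuousOn A (Icc a c))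
    (h1 : SolvesL A a b x g) (h2 : SolvesL A b c x g) : SolvesL A a c x g := by
  have hac := hab.trans hbc
  have hA1 := hA.mono (Icc_subset_Icc_right hbc)
  have hA2 := hA.mono (Icc_subset_Icc_left hab)
  have hc : ContinuousOn x (Icc a c) := by
    rw [← Icc_union_Icc_eq_Icc hab hbc]
    exact (h1.1.continuousOn hab).union_of_isClosed (h2.1.continuousOn hbc) isClosed_Icc
      isClosed_Icc
  have hg : IsL2 a c g := by
    have e : Ioo a c ⊆ Ioo a b ∪ ({b} ∪ Ioo b c) := fun t ht => by
      rcases lt_trichotomy t b with h | h | h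
      · exact Or.inl ⟨ht.1, h⟩
      · exact Or.inr (Or.inl h)
      · exact Or.inr (Or.inr ⟨h, ht.2⟩)
    have hl := isL2_iff.1 (h1.isL2 hab hA1)
    have hr := isL2_iff.1 (h2.isL2 hbc hA2)
    refine isL2_iff.2 fun i => ?_
    have hn : volume.restrict ({b} ∪ Ioo b c) = volume.restrict (Ioo b c) := by
      refine Measure.restrict_congr_set ?_
      have : (({b} : Set ℝ) : Set ℝ) =ᵐ[volume] (∅ : Set ℝ) := by simp
      simpa using this.union (ae_eq_refl (Ioo b c))
    refine MemLp.mono_measure (Measure.restrict_mono e le_rfl) ?_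
    refine MemLp.mono_measure (Measure.restrict_union_le _ _) ?_
    rw [hn, memLp_two_iff_integrable_sq ((hl i).1.add_measure (hr i).1)]
    exact ((memLp_two_iff_integrable_sq (hl i).1).1 (hl i)).add_measure
      ((memLp_two_iff_integrable_sq (hr i).1).1 (hr i))
  refine solvesL_of_integral hac hA hg hc fun t ht i => ?_
  rcases le_total t b with h | h
  · exact h1.integral_eq ⟨ht.1, h⟩ i
  · rw [h2.integral_eq ⟨h, ht.2⟩ i, h1.integral_eq (right_mem_Icc.2 hab) i, add_assoc,
      intervalIntegral.integral_add_adjacent_intervals]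
    · exact MemLp.intervalIntegrable hab (isL2_iff.1 ((h1.isL2 hab hA1).sub
        ((ContinuousOn.isL2 (h1.1.continuousOn hab)).mulVec hA1)) i)
    · have h3 := h2.mono le_rfl h ht.2
      have hA3 := hA2.mono (Icc_subset_Icc_right ht.2)
      exact MemLp.intervalIntegrable h (isL2_iff.1 ((h3.isL2 h hA3).sub
        ((ContinuousOn.isL2 (h3.1.continuousOn h)).mulVec hA3)) i)

/-- Every fact about L transfers to L* through the coefficient −Aᵀ and a change of sign on the
right. -/
theorem solvesLstar_iff : SolvesLstar A a b x g ↔ SolvesL (fun t => -(A t)ᵀ) a b x (-g) := by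
  refine and_congr Iff.rfl (Filter.eventually_congr (Filter.Eventually.of_forall fun t => ?_))
  have : opL (fun t => -(A t)ᵀ) x t = -opLstar A x t := by
    ext i
    simp [opL, opLstar, Matrix.neg_mulVec, add_comm]
  rw [this, Pi.neg_apply, neg_inj]

theorem continuousOn_neg_transpose {s : Set ℝ} (hA : ContinuousOn A s) :
    ContinuousOn (fun t => -(A t)ᵀ) s :=
  (Continuous.matrix_transpose continuous_id).neg.comp_continuousOn hA

theorem SolvesLstar.mono (hx : SolvesLstar A a b x g) (hac : a ≤ c) (hcd : c ≤ d) (hdb : d ≤ b) :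
    SolvesLstar A c d x g :=
  solvesLstar_iff.2 ((solvesLstar_iff.1 hx).mono hac hcd hdb)

theorem SolvesLstar.congr_rhs (hx : SolvesLstar A a b x g)
    (hgh : ∀ᵐ t ∂volume.restrict (Ioo a b), g t = h t) : SolvesLstar A a b x h :=
  ⟨hx.1, by filter_upwards [hx.2, hgh] with t h1 h2 using h1.trans h2⟩

theorem SolvesLstar.congr (hx : SolvesLstar A a b x g) (hab : a ≤ b) (hxy : EqOn x y (Icc a b)) :
    SolvesLstar A a b y g :=
  solvesLstar_iff.2 ((solvesLstar_iff.1 hx).congr hab hxy)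

theorem SolvesLstar.sub (hab : a ≤ b) (hx : SolvesLstar A a b x g) (hy : SolvesLstar A a b y h) :
    SolvesLstar A a b (fun t => x t - y t) (fun t => g t - h t) := by
  refine solvesLstar_iff.2 (((solvesLstar_iff.1 hx).sub hab (solvesLstar_iff.1 hy)).congr_rhs ?_)
  refine Filter.Eventually.of_forall fun t => ?_
  simp only [Pi.neg_apply]
  abel

theorem SolvesLstar.glue (hab : a ≤ b) (hbc : b ≤ c) (hA : ContinuousOn A (Icc a c))
    (h1 : SolvesLstar A a b x g) (h2 : SolvesLstar A b c x g) : SolvesLstar A a c x g :=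
  solvesLstar_iff.2 (SolvesL.glue hab hbc (continuousOn_neg_transpose hA) (solvesLstar_iff.1 h1)
    (solvesLstar_iff.1 h2))

theorem SolvesLstar.isL2 (hab : a ≤ b) (hA : ContinuousOn A (Icc a b))
    (hx : SolvesLstar A a b x g) : IsL2 a b g := by
  have := (solvesLstar_iff.1 hx).isL2 hab (continuousOn_neg_transpose hA)
  have h2 := MemLp.neg this
  rwa [neg_neg] at h2

/-- Lagrange's identity for `L` and `L*`. -/
theorem SolvesL.lagrange (hab : a ≤ b) (hA : ContinuousOn A (Icc a b))
    (hx : SolvesL A a b x g) (hy : SolvesLstar A a b y h) :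
    (∫ t in a..b, g t ⬝ᵥ y t) - ∫ t in a..b, x t ⬝ᵥ h t = x b ⬝ᵥ y b - x a ⬝ᵥ y a := by
  have hxc := hx.1.continuousOn hab
  have hyc := hy.1.continuousOn hab
  have hg := hx.isL2 hab hA
  have hh := hy.isL2 hab hA
  rw [← intervalIntegral.integral_sub
    (hg.intervalIntegrable_dotProduct hab (ContinuousOn.isL2 hyc))
    ((ContinuousOn.isL2 hxc).intervalIntegrable_dotProduct hab hh)]
  have h1 : ∀ i, ∫ t in a..b, (deriv (fun τ => x τ i) t * y t i + x t i * deriv (fun τ => y τ i) t)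
      = x b i * y b i - x a i * y a i := fun i =>
    (hx.1 i).1.integral_deriv_mul_eq_sub (hy.1 i).1
  simp only [dotProduct, ← Finset.sum_sub_distrib]
  rw [← Finset.sum_congr rfl fun i _ => h1 i, ← intervalIntegral.integral_finsetSum]
  · refine intervalIntegral_congr_Ioo hab ?_
    filter_upwards [hx.2, hy.2] with t h1 h2
    rw [← h1, ← h2]
    -- The zeroth-order terms of L and L* cancel, which leaves the product rule for absolutely
    -- continuous functions.
    have e : (A t *ᵥ x t) ⬝ᵥ y t = x t ⬝ᵥ ((A t)ᵀ *ᵥ y t) := by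
      rw [Matrix.dotProduct_mulVec, Matrix.vecMul_transpose]
    simp only [dotProduct] at e
    simp only [opL, opLstar, add_mul, mul_add, Finset.sum_add_distrib, Finset.sum_sub_distrib, e,
      mul_neg, Finset.sum_neg_distrib]
    ring
  · intro i _
    refine (MemLp.intervalIntegrable hab (memLp_continuousOn_mul
      (f := fun t => y t i) ((continuous_apply i).comp_continuousOn hyc) (hx.1 i).2)).congr ?_ |>.add
      (MemLp.intervalIntegrable hab (memLp_continuousOn_mul
      (f := fun t => x t i) ((continuous_apply i).comp_continuousOn hxc) (hy.1 i).2))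
    exact fun t _ => mul_comm _ _

end Operator

/-! ### Linear ordinary differential equations in integral form -/

section Volterra

theorem IntegrableOn.intervalIntegrable_zero {E : Type*} [NormedAddCommGroup E] {T : ℝ}
    {f : ℝ → E} (hf : IntegrableOn f (Icc 0 T)) {t : ℝ}
    (ht : t ∈ Icc 0 T) : IntervalIntegrable f volume 0 t :=
  (intervalIntegrable_iff_integrableOn_Ioc_of_le ht.1).2
    (hf.mono_set fun _ hτ => ⟨hτ.1.le, hτ.2.trans ht.2⟩)

variable {E E' : Type*} [NormedAddCommGroup E] [NormedSpace ℝ E]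

/-- The field `B` of linear maps on `[0, T]` is bounded, and measurable along continuous curves. -/
structure IsBoundedField (T : ℝ) (B : ℝ → E →ₗ[ℝ] E) : Prop where
  bound : ∃ C, 0 ≤ C ∧ ∀ t ∈ Icc 0 T, ∀ v, ‖B t v‖ ≤ C * ‖v‖
  meas : ∀ x : ℝ → E, ContinuousOn x (Icc 0 T) →
    AEStronglyMeasurable (fun t => B t (x t)) (volume.restrict (Icc 0 T))

variable {T : ℝ} {B : ℝ → E →ₗ[ℝ] E}

theorem IsBoundedField.integrableOn (hB : IsBoundedField T B) {x : ℝ → E}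
    (hx : ContinuousOn x (Icc 0 T)) : IntegrableOn (fun t => B t (x t)) (Icc 0 T) := by
  obtain ⟨C, hC, hb⟩ := hB.bound
  obtain ⟨K, hK⟩ := isCompact_Icc.exists_bound_of_continuousOn hx
  refine Integrable.of_bound (hB.meas x hx) (C * K) ?_
  refine (ae_restrict_iff' measurableSet_Icc).2 (Filter.Eventually.of_forall fun t ht => ?_)
  exact (hb t ht _).trans (mul_le_mul_of_nonneg_left (hK t ht) hC)

theorem IntegrableOn.continuousOn_primitive {f : ℝ → E} (hf : IntegrableOn f (Icc 0 T))
    (hT : 0 ≤ T) : ContinuousOn (fun t => ∫ τ in (0 : ℝ)..t, f τ) (Icc 0 T) := by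
  rw [← uIcc_of_le hT] at hf ⊢
  exact intervalIntegral.continuousOn_primitive_interval hf

/-- The Volterra operator of the field `B`. -/
noncomputable def volterra (B : ℝ → E →ₗ[ℝ] E) (x : ℝ → E) (t : ℝ) : E :=
  ∫ τ in (0 : ℝ)..t, B τ (x τ)

theorem continuousOn_volterra_iterate (hT : 0 ≤ T) (hB : IsBoundedField T B) {x : ℝ → E}
    (hx : ContinuousOn x (Icc 0 T)) (k : ℕ) : ContinuousOn ((volterra B)^[k] x) (Icc 0 T) := by
  induction k with
  | zero => exact hx
  | succ k ih =>
    rw [Function.iterate_succ_apply']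
    exact IntegrableOn.continuousOn_primitive (hB.integrableOn ih) hT

/-- Integrating the k-th term of an exponential series produces the next one. The factorial decay
holds on an interval of any length, so no smallness of T is needed. -/
theorem norm_volterra_le {C K : ℝ} (hC : 0 ≤ C) (hb : ∀ t ∈ Icc 0 T, ∀ v, ‖B t v‖ ≤ C * ‖v‖)
    {x : ℝ → E} {k : ℕ} (hx : ∀ t ∈ Icc 0 T, ‖x t‖ ≤ K * ((C * t) ^ k / k.factorial)) {t : ℝ}
    (ht : t ∈ Icc 0 T) :
    ‖volterra B x t‖ ≤ K * ((C * t) ^ (k + 1) / (k + 1).factorial) := by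
  have h1 : ‖volterra B x t‖ ≤ ∫ τ in (0 : ℝ)..t, C * (K * ((C * τ) ^ k / k.factorial)) := by
    refine intervalIntegral.norm_integral_le_of_norm_le ht.1 ?_ ?_
    · refine Filter.Eventually.of_forall fun τ hτ => ?_
      have hτ' : τ ∈ Icc 0 T := ⟨hτ.1.le, hτ.2.trans ht.2⟩
      exact (hb τ hτ' _).trans (mul_le_mul_of_nonneg_left (hx τ hτ') hC)
    · exact Continuous.intervalIntegrable (by fun_prop) _ _
  refine h1.trans_eq ?_
  have h2 : ∀ τ : ℝ, C * (K * ((C * τ) ^ k / k.factorial))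
      = (C * K * C ^ k / k.factorial) * τ ^ k := fun τ => by rw [mul_pow]; ring
  simp only [h2]
  rw [intervalIntegral.integral_const_mul, integral_pow, Nat.factorial_succ]
  have : (k.factorial : ℝ) ≠ 0 := by positivity
  have : (k + 1 : ℝ) ≠ 0 := by positivity
  push_cast
  field_simp
  ring

theorem norm_volterra_iterate_le {C K : ℝ} (hC : 0 ≤ C)
    (hb : ∀ t ∈ Icc 0 T, ∀ v, ‖B t v‖ ≤ C * ‖v‖) {x : ℝ → E}
    (hx : ∀ t ∈ Icc 0 T, ‖x t‖ ≤ K) (k : ℕ) :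
    ∀ t ∈ Icc 0 T, ‖(volterra B)^[k] x t‖ ≤ K * ((C * t) ^ k / k.factorial) := by
  induction k with
  | zero => simpa using hx
  | succ k ih =>
    intro t ht
    rw [Function.iterate_succ_apply']
    exact norm_volterra_le hC hb ih ht

/-- The equation feeds the bound back into itself, so `x` is bounded by every term K(Ct)^k/k!, and
these tend to 0. -/
theorem eq_zero_of_volterra_eq (hB : IsBoundedField T B) {x : ℝ → E}
    (hx : ContinuousOn x (Icc 0 T)) (h : ∀ t ∈ Icc 0 T, x t = volterra B x t) :
    ∀ t ∈ Icc 0 T, x t = 0 := by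
  obtain ⟨C, hC, hb⟩ := hB.bound
  obtain ⟨K, hK⟩ := isCompact_Icc.exists_bound_of_continuousOn hx
  have h1 : ∀ k : ℕ, ∀ t ∈ Icc 0 T, ‖x t‖ ≤ K * ((C * t) ^ k / k.factorial) := by
    intro k
    induction k with
    | zero => simpa using hK
    | succ k ih =>
      intro t ht
      rw [h t ht]
      exact norm_volterra_le hC hb ih ht
  intro t ht
  have h2 := (FloorSemiring.tendsto_pow_div_factorial_atTop (C * t)).const_mul K
  rw [mul_zero] at h2
  exact norm_le_zero_iff.1 (ge_of_tendsto' h2 fun k => h1 k t ht)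

/-- Neumann series: the iterates of the operator on `h` are dominated by an exponential series, and
dominated convergence moves the operator inside the sum. -/
theorem exists_volterra_solution [CompleteSpace E] (hT : 0 ≤ T) (hB : IsBoundedField T B)
    {h : ℝ → E} (hh : ContinuousOn h (Icc 0 T)) :
    ∃ x : ℝ → E, ContinuousOn x (Icc 0 T) ∧ ∀ t ∈ Icc 0 T, x t = h t + volterra B x t := by
  obtain ⟨C, hC, hb⟩ := hB.bound
  obtain ⟨K, hK⟩ := isCompact_Icc.exists_bound_of_continuousOn hh
  have hK0 : 0 ≤ K := (norm_nonneg _).trans (hK 0 ⟨le_rfl, hT⟩)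
  set u : ℕ → ℝ := fun k => K * ((C * T) ^ k / k.factorial) with hu
  have hus : Summable u := (Real.summable_pow_div_factorial _).mul_left K
  have hle : ∀ k, ∀ t ∈ Icc 0 T, ‖(volterra B)^[k] h t‖ ≤ u k := fun k t ht => by
    refine (norm_volterra_iterate_le hC hb hK k t ht).trans ?_
    have := ht.1
    have := ht.2
    simp only [hu]
    gcongr
  have hsum : ∀ t ∈ Icc 0 T, Summable fun k => (volterra B)^[k] h t := fun t ht =>
    Summable.of_norm_bounded hus fun k => hle k t ht
  have hcont := continuousOn_volterra_iterate hT hB hh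
  refine ⟨fun t => ∑' k, (volterra B)^[k] h t, continuousOn_tsum hcont hus hle, fun t ht => ?_⟩
  beta_reduce
  rw [(hsum t ht).tsum_eq_zero_add]
  congr 1
  simp only [Function.iterate_succ_apply']
  refine HasSum.tsum_eq ?_
  refine intervalIntegral.hasSum_integral_of_dominated_convergence (fun k _ => C * u k) ?_ ?_ ?_ ?_ ?_
  · intro k
    exact (IntegrableOn.intervalIntegrable_zero (hB.integrableOn (hcont k)) ht).def'.1
  · refine fun k => Filter.Eventually.of_forall fun τ hτ => ?_
    rw [uIoc_of_le ht.1] at hτ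
    have hτ' : τ ∈ Icc 0 T := ⟨hτ.1.le, hτ.2.trans ht.2⟩
    exact (hb τ hτ' _).trans (mul_le_mul_of_nonneg_left (hle k τ hτ') hC)
  · exact Filter.Eventually.of_forall fun _ _ => hus.mul_left C
  · exact intervalIntegrable_const
  · refine Filter.Eventually.of_forall fun τ hτ => ?_
    rw [uIoc_of_le ht.1] at hτ
    have hτ' : τ ∈ Icc 0 T := ⟨hτ.1.le, hτ.2.trans ht.2⟩
    exact ((B τ).mkContinuous C (hb τ hτ')).hasSum (hsum τ hτ').hasSum

theorem volterra_add_smul (hB : IsBoundedField T B) {x y : ℝ → E} (hx : ContinuousOn x (Icc 0 T))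
    (hy : ContinuousOn y (Icc 0 T)) (r : ℝ) {t : ℝ} (ht : t ∈ Icc 0 T) :
    volterra B (fun t => x t + r • y t) t = volterra B x t + r • volterra B y t := by
  simp only [volterra, map_add, map_smul]
  rw [intervalIntegral.integral_add, intervalIntegral.integral_smul]
  · exact IntegrableOn.intervalIntegrable_zero (hB.integrableOn hx) ht
  · exact IntegrableOn.intervalIntegrable_zero ((hB.integrableOn hy).smul r) ht

/-- Fredholm alternative for linear two-point boundary value problems: if the homogeneous problem
has only the trivial solution, then the inhomogeneous problem is solvable. -/
theorem exists_boundaryValue_solution [FiniteDimensional ℝ E] [AddCommGroup E'] [Module ℝ E']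
    [FiniteDimensional ℝ E'] (hdim : Module.finrank ℝ E = Module.finrank ℝ E') (hT : 0 ≤ T)
    (hB : IsBoundedField T B) (U V : E →ₗ[ℝ] E')
    (huniq : ∀ x : ℝ → E, ContinuousOn x (Icc 0 T) →
      (∀ t ∈ Icc 0 T, x t = x 0 + volterra B x t) → U (x 0) + V (x T) = 0 → x 0 = 0)
    {g : ℝ → E} (hg : IntegrableOn g (Icc 0 T)) (r : E') :
    ∃ x : ℝ → E, ContinuousOn x (Icc 0 T) ∧
      (∀ t ∈ Icc 0 T, x t = x 0 + ((∫ τ in (0 : ℝ)..t, g τ) + volterra B x t)) ∧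
      U (x 0) + V (x T) = r := by
  have : CompleteSpace E := FiniteDimensional.complete ℝ E
  choose sol hsolc hsol using fun v : E =>
    exists_volterra_solution hT hB (h := fun _ => v) continuousOn_const
  have hT' : T ∈ Icc 0 T := ⟨hT, le_rfl⟩
  have h0 : ∀ x : ℝ → E, volterra B x 0 = 0 := fun x => intervalIntegral.integral_same
  have hsol0 : ∀ v, sol v 0 = v := fun v => by
    have := hsol v 0 ⟨le_rfl, hT⟩
    rwa [h0, add_zero] at this
  have hlin : ∀ v w : E, ∀ r : ℝ, sol (v + r • w) T = sol v T + r • sol w T := by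
    intro v w r
    have hc : ContinuousOn (fun t => sol v t + r • sol w t) (Icc 0 T) :=
      (hsolc v).add ((hsolc w).const_smul r)
    -- The defect of linearity solves the homogeneous Volterra equation with initial value 0.
    have hz := eq_zero_of_volterra_eq hB
      (x := fun t => sol (v + r • w) t + (-1 : ℝ) • (sol v t + r • sol w t))
      ((hsolc _).add (hc.const_smul (-1 : ℝ))) (fun t ht => by
        rw [volterra_add_smul hB (hsolc _) hc _ ht, volterra_add_smul hB (hsolc _) (hsolc _) _ ht,
          hsol _ t ht, hsol v t ht, hsol w t ht]
        module) T hT'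
    rw [neg_one_smul, add_neg_eq_zero] at hz
    exact hz
  let Λ : E →ₗ[ℝ] E :=
    { toFun := fun v => sol v T
      map_add' := fun v w => by simpa using hlin v w 1
      map_smul' := fun c v => by
        -- This instance reads sol 0 T = sol 0 T + sol 0 T, so the zero initial value gives zero at
        -- T.
        have h2 := hlin 0 0 1
        have h1 := hlin 0 v c
        simp only [smul_zero, add_zero, zero_add, one_smul, left_eq_add] at h1 h2
        simpa [h2] using h1 }
  -- Shooting map: initial value to boundary value. Uniqueness makes it injective, and equality of
  -- dimensions makes it surjective.
  let W : E →ₗ[ℝ] E' := U + V ∘ₗ Λ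
  have hinj : Function.Injective W := by
    refine (injective_iff_map_eq_zero W).2 fun v hv => ?_
    have := huniq (sol v) (hsolc v) (fun t ht => by rw [hsol0]; exact hsol v t ht)
      (by rw [hsol0]; exact hv)
    rwa [hsol0] at this
  have hsurj : Function.Surjective W :=
    (LinearMap.injective_iff_surjective_of_finrank_eq_finrank hdim).1 hinj
  -- A particular solution starting at 0; the homogeneous solution added below repairs its boundary
  -- value.
  obtain ⟨xp, hxpc, hxp⟩ := exists_volterra_solution hT hB
    (IntegrableOn.continuousOn_primitive hg hT)
  have hxp0 : xp 0 = 0 := by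
    have := hxp 0 ⟨le_rfl, hT⟩
    rwa [h0, add_zero, intervalIntegral.integral_same] at this
  obtain ⟨v, hv⟩ := hsurj (r - V (xp T))
  refine ⟨fun t => xp t + (1 : ℝ) • sol v t, hxpc.add ((hsolc v).const_smul _), fun t ht => ?_, ?_⟩
  · beta_reduce
    rw [volterra_add_smul hB hxpc (hsolc v) _ ht, hxp0, hsol0, hxp t ht, hsol v t ht]
    module
  · have hv' : U v + V (sol v T) = r - V (xp T) := hv
    beta_reduce
    rw [hxp0, hsol0, one_smul, one_smul, zero_add, map_add]
    rw [add_comm (V (xp T)), ← add_assoc, hv', sub_add_cancel]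

end Volterra

/-! ### Continuity of products along curves. -/

theorem continuousOn_mulVec {p q : Type*} [Fintype q] {M : ℝ → Matrix p q ℝ} {x : ℝ → q → ℝ}
    {s : Set ℝ} (hM : ContinuousOn M s) (hx : ContinuousOn x s) :
    ContinuousOn (fun t => M t *ᵥ x t) s :=
  (continuous_fst.matrix_mulVec continuous_snd).comp_continuousOn (hM.prodMk hx)

theorem continuousOn_dotProduct {q : Type*} [Fintype q] {x y : ℝ → q → ℝ} {s : Set ℝ}
    (hx : ContinuousOn x s) (hy : ContinuousOn y s) : ContinuousOn (fun t => x t ⬝ᵥ y t) s :=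
  continuousOn_finsetSum _ fun i _ => ((continuous_apply i).comp_continuousOn hx).mul
    ((continuous_apply i).comp_continuousOn hy)

/-! ### Positive definite matrices -/

section PosDef

variable {ι : Type*} [Fintype ι] {M : Matrix ι ι ℝ}

theorem _root_.Matrix.PosDef.mulVec_dotProduct_nonneg (hM : M.PosDef) (x : ι → ℝ) :
    0 ≤ (M *ᵥ x) ⬝ᵥ x := by
  simpa [dotProduct_comm] using hM.posSemidef.dotProduct_mulVec_nonneg x

theorem _root_.Matrix.PosDef.mulVec_dotProduct_pos (hM : M.PosDef) {x : ι → ℝ} (hx : x ≠ 0) :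
    0 < (M *ᵥ x) ⬝ᵥ x := by
  simpa [dotProduct_comm] using hM.dotProduct_mulVec_pos hx

theorem _root_.Matrix.PosDef.eq_zero_of_mulVec_dotProduct (hM : M.PosDef) {x : ι → ℝ}
    (hx : (M *ᵥ x) ⬝ᵥ x = 0) : x = 0 := by
  by_contra h
  exact (hM.mulVec_dotProduct_pos h).ne' hx

theorem _root_.Matrix.PosDef.mulVec_dotProduct_comm (hM : M.PosDef) (x y : ι → ℝ) :
    (M *ᵥ x) ⬝ᵥ y = (M *ᵥ y) ⬝ᵥ x := by
  have h : Mᵀ = M := by simpa [Matrix.IsHermitian] using hM.isHermitian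
  conv_lhs => rw [← h]
  rw [Matrix.mulVec_transpose, ← Matrix.dotProduct_mulVec, dotProduct_comm]

variable [DecidableEq ι]

theorem _root_.Matrix.PosDef.isUnit_det (hM : M.PosDef) : IsUnit M.det :=
  isUnit_iff_ne_zero.2 hM.det_pos.ne'

theorem _root_.Matrix.PosDef.mulVec_inv_mulVec (hM : M.PosDef) (x : ι → ℝ) :
    M *ᵥ (M⁻¹ *ᵥ x) = x := by
  rw [Matrix.mulVec_mulVec, Matrix.mul_nonsing_inv _ hM.isUnit_det, Matrix.one_mulVec]

theorem _root_.Matrix.PosDef.inv_mulVec_mulVec (hM : M.PosDef) (x : ι → ℝ) :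
    M⁻¹ *ᵥ (M *ᵥ x) = x := by
  rw [Matrix.mulVec_mulVec, Matrix.nonsing_inv_mul _ hM.isUnit_det, Matrix.one_mulVec]

theorem continuousOn_inv_of_posDef {M : ℝ → Matrix ι ι ℝ} {s : Set ℝ} (hM : ContinuousOn M s)
    (hpd : ∀ t ∈ s, (M t).PosDef) : ContinuousOn (fun t => (M t)⁻¹) s := by
  simp only [Matrix.inv_def, Ring.inverse_eq_inv']
  refine ContinuousOn.smul (ContinuousOn.inv₀ ?_ fun t ht => (hpd t ht).det_pos.ne') ?_
  · exact (Continuous.matrix_det continuous_id).comp_continuousOn hM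
  · exact (Continuous.matrix_adjugate continuous_id).comp_continuousOn hM

end PosDef

/-! ### The boundary matrices -/

section BoundaryMatrices

variable {p q ν : Type*} [Fintype p] [Fintype q] [Fintype ν]

theorem mulVec_eq_selBlock_add_restBlock (e : p ⊕ q ≃ ν) (B : Matrix p ν ℝ) (x : ν → ℝ) :
    B *ᵥ x = selBlock e B *ᵥ (fun k => x (e (Sum.inl k)))
      + restBlock e B *ᵥ fun k => x (e (Sum.inr k)) := by
  ext i
  simp only [Matrix.mulVec, dotProduct, Pi.add_apply, selBlock, restBlock, Matrix.submatrix_apply,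
    id]
  rw [← e.sum_comp, Fintype.sum_sum_type]

variable [DecidableEq p]

theorem barMat_mulVec (e : p ⊕ q ≃ ν) (B : Matrix p ν ℝ) (z : ν → ℝ) :
    barMat e B *ᵥ z = ((selBlock e B)ᵀ)⁻¹ *ᵥ fun k => z (e (Sum.inl k)) := by
  simp only [barMat, Matrix.submatrix_mulVec_equiv, Matrix.fromCols_mulVec, Matrix.zero_mulVec,
    add_zero]
  rfl

variable [DecidableEq q]

theorem hatMat_mulVec (e : p ⊕ q ≃ ν) (B : Matrix p ν ℝ) (z : ν → ℝ) :
    hatMat e B *ᵥ z = (fun k => z (e (Sum.inr k))) - (restBlock e B)ᵀ *ᵥ (barMat e B *ᵥ z) := by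
  simp only [hatMat, barMat_mulVec, Matrix.submatrix_mulVec_equiv, Matrix.fromCols_mulVec,
    Matrix.one_mulVec, Matrix.mulVec_mulVec, Matrix.neg_mulVec, neg_add_eq_sub]
  rfl

/-- Split z · x into selected and remaining coordinates and express the selected part of x through
Bx and the rest. Hence B̂z = 0 says that z annihilates ker B, and B̄z is then the multiplier with z
= BᵀB̄z; this turns the boundary terms of Lagrange's identity into the given boundary data. -/
theorem dotProduct_eq_barMat_add_hatMat (e : p ⊕ q ≃ ν) {B : Matrix p ν ℝ}
    (hB : (selBlock e B).det ≠ 0) (z x : ν → ℝ) :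
    z ⬝ᵥ x = (barMat e B *ᵥ z) ⬝ᵥ (B *ᵥ x) + (hatMat e B *ᵥ z) ⬝ᵥ fun k => x (e (Sum.inr k)) := by
  have h1 : (barMat e B *ᵥ z) ⬝ᵥ (selBlock e B *ᵥ fun k => x (e (Sum.inl k)))
      = (fun k => z (e (Sum.inl k))) ⬝ᵥ fun k => x (e (Sum.inl k)) := by
    rw [barMat_mulVec, Matrix.dotProduct_mulVec, ← Matrix.mulVec_transpose, Matrix.mulVec_mulVec,
      Matrix.mul_nonsing_inv _ (by rw [Matrix.det_transpose]; exact isUnit_iff_ne_zero.2 hB),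
      Matrix.one_mulVec]
  rw [mulVec_eq_selBlock_add_restBlock e B, dotProduct_add, h1, hatMat_mulVec, sub_dotProduct,
    Matrix.dotProduct_mulVec, ← Matrix.mulVec_transpose]
  simp only [dotProduct]
  rw [← e.sum_comp, Fintype.sum_sum_type]
  ring

theorem dotProduct_eq_of_hatMat_eq_zero (e : p ⊕ q ≃ ν) {B : Matrix p ν ℝ}
    (hB : (selBlock e B).det ≠ 0) {z : ν → ℝ} (hz : hatMat e B *ᵥ z = 0) (x : ν → ℝ) :
    x ⬝ᵥ z = (B *ᵥ x) ⬝ᵥ (barMat e B *ᵥ z) := by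
  rw [dotProduct_comm, dotProduct_eq_barMat_add_hatMat e hB, hz, zero_dotProduct, add_zero,
    dotProduct_comm]

end BoundaryMatrices

/-! ### Boundary value problems for linear systems -/

/-- Writes separate conditions at 0 and at T in the joint form U x(0) + V x(T) required by the
Fredholm alternative. -/
theorem prod_zero_apply_add_zero_prod_apply {E F G : Type*} [AddCommGroup E] [Module ℝ E]
    [AddCommGroup F] [Module ℝ F] [AddCommGroup G] [Module ℝ G] (U : E →ₗ[ℝ] F) (V : E →ₗ[ℝ] G)
    (a b : E) : (U.prod 0 : E →ₗ[ℝ] F × G) a + (LinearMap.prod 0 V : E →ₗ[ℝ] F × G) b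
      = (U a, V b) :=
  Prod.ext (add_zero _) (zero_add _)

section MatrixField

variable {ι : Type*} [Fintype ι] {T : ℝ}

/-- The entries of the matrix `M` are bounded and measurable on `[0, T]`. -/
def IsBoundedMeasurable {p q : Type*} (T : ℝ) (M : ℝ → Matrix p q ℝ) : Prop :=
  ∀ i j, (∃ C, ∀ t ∈ Icc 0 T, |M t i j| ≤ C) ∧
    AEStronglyMeasurable (fun t => M t i j) (volume.restrict (Icc 0 T))

theorem ContinuousOn.isBoundedMeasurable {p q : Type*} {M : ℝ → Matrix p q ℝ}
    (hM : ContinuousOn M (Icc 0 T)) : IsBoundedMeasurable T M := fun i j =>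
  ⟨isCompact_Icc.exists_bound_of_continuousOn (continuousOn_entry hM i j),
    (continuousOn_entry hM i j).aestronglyMeasurable measurableSet_Icc⟩

/-- Needed because HᵀQH, continued by zero, may jump at the ends of the observation interval;
continuity of the coefficients is therefore too much to ask. -/
theorem isBoundedMeasurable_indicator {p q : Type*} {M : ℝ → Matrix p q ℝ} {a b : ℝ}
    (hM : ContinuousOn M (Icc a b)) : IsBoundedMeasurable T ((Ioo a b).indicator M) := by
  intro i j
  have he : (fun t => (Ioo a b).indicator M t i j) = (Ioo a b).indicator fun t => M t i j := by
    ext t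
    by_cases ht : t ∈ Ioo a b <;> simp [ht]
  obtain ⟨C, hC⟩ := isCompact_Icc.exists_bound_of_continuousOn (continuousOn_entry hM i j)
  refine ⟨⟨max C 0, fun t _ => ?_⟩, ?_⟩
  · by_cases ht : t ∈ Ioo a b
    · simp only [ht, indicator_of_mem]
      exact (hC t (Ioo_subset_Icc_self ht)).trans (le_max_left _ _)
    · simp [ht]
  · rw [he, aestronglyMeasurable_indicator_iff measurableSet_Ioo, Measure.restrict_restrict
      measurableSet_Ioo]
    exact ((continuousOn_entry hM i j).aestronglyMeasurable measurableSet_Icc).mono_measure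
      (Measure.restrict_mono (inter_subset_left.trans Ioo_subset_Icc_self) le_rfl)

theorem IsBoundedMeasurable.isBoundedField {M : ℝ → Matrix ι ι ℝ}
    (hM : IsBoundedMeasurable T M) : IsBoundedField T fun t => (M t).mulVecLin := by
  choose C hC using fun i j => (hM i j).1
  refine ⟨⟨∑ i, ∑ j, |C i j|, by positivity, fun t ht v => ?_⟩, fun x hx => ?_⟩
  · refine (pi_norm_le_iff_of_nonneg (by positivity)).2 fun i => ?_
    have h1 : ∑ j, |C i j| ≤ ∑ i, ∑ j, |C i j| :=
      Finset.single_le_sum (f := fun i => ∑ j, |C i j|)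
        (fun _ _ => Finset.sum_nonneg fun _ _ => abs_nonneg _) (Finset.mem_univ i)
    refine le_trans ?_ (mul_le_mul_of_nonneg_right h1 (norm_nonneg v))
    rw [Finset.sum_mul]
    refine (norm_sum_le _ _).trans (Finset.sum_le_sum fun j _ => ?_)
    rw [norm_mul]
    exact mul_le_mul ((hC i j t ht).trans (le_abs_self _)) (norm_le_pi_norm v j) (norm_nonneg _)
      (abs_nonneg _)
  · refine (aemeasurable_pi_iff.2 fun i => ?_).aestronglyMeasurable
    simp only [Matrix.mulVecLin_apply, Matrix.mulVec, dotProduct]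
    refine (Finset.aestronglyMeasurable_fun_sum _ fun j _ => (hM i j).2.mul ?_).aemeasurable
    exact ((continuous_apply j).comp_continuousOn hx).aestronglyMeasurable measurableSet_Icc

theorem exists_matrix_boundaryValue_solution {E' : Type*} [AddCommGroup E'] [Module ℝ E']
    [FiniteDimensional ℝ E'] (hdim : Fintype.card ι = Module.finrank ℝ E') (hT : 0 ≤ T)
    {M : ℝ → Matrix ι ι ℝ} (hM : IsBoundedMeasurable T M) (U V : (ι → ℝ) →ₗ[ℝ] E')
    (huniq : ∀ x : ℝ → ι → ℝ, ContinuousOn x (Icc 0 T) →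
      (∀ t ∈ Icc 0 T, ∀ i, x t i = x 0 i + ∫ τ in (0 : ℝ)..t, (M τ *ᵥ x τ) i) →
      U (x 0) + V (x T) = 0 → x 0 = 0)
    {g : ℝ → ι → ℝ} (hg : ∀ i, IntegrableOn (fun t => g t i) (Icc 0 T)) (r : E') :
    ∃ x : ℝ → ι → ℝ, ContinuousOn x (Icc 0 T) ∧
      (∀ t ∈ Icc 0 T, ∀ i, x t i = x 0 i + ∫ τ in (0 : ℝ)..t, (g τ i + (M τ *ᵥ x τ) i)) ∧
      U (x 0) + V (x T) = r := by
  have hB := hM.isBoundedField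
  have hg' : IntegrableOn g (Icc 0 T) := Integrable.of_eval hg
  have hcomp : ∀ {f : ℝ → ι → ℝ}, IntegrableOn f (Icc 0 T) → ∀ t ∈ Icc 0 T, ∀ i,
      (∫ τ in (0 : ℝ)..t, f τ) i = ∫ τ in (0 : ℝ)..t, f τ i := fun hf t ht i =>
    ((ContinuousLinearMap.proj (R := ℝ) i).intervalIntegral_comp_comm
      (IntegrableOn.intervalIntegrable_zero hf ht)).symm
  obtain ⟨x, hxc, hx, hr⟩ := exists_boundaryValue_solution (by simpa using hdim) hT hB U V
    (fun x hxc hx hbd => huniq x hxc (fun t ht i => by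
      have := congrFun (hx t ht) i
      rw [Pi.add_apply, volterra, hcomp (hB.integrableOn hxc) t ht] at this
      exact this) hbd) hg' r
  refine ⟨x, hxc, fun t ht i => ?_, hr⟩
  have h1 := congrFun (hx t ht) i
  rw [Pi.add_apply, Pi.add_apply, volterra, hcomp (hB.integrableOn hxc) t ht,
    hcomp hg' t ht] at h1
  have h2 := IntegrableOn.intervalIntegrable_zero (hg i) ht
  have h3 : IntervalIntegrable (fun τ => (M τ *ᵥ x τ) i) volume 0 t :=
    IntegrableOn.intervalIntegrable_zero (Integrable.eval (hB.integrableOn hxc) i) ht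
  rw [h1, intervalIntegral.integral_add h2 h3]
  rfl

end MatrixField

theorem isL2_indicator {k : ℕ} {a b c d : ℝ} {x : ℝ → Fin k → ℝ} (hx : IsL2 c d x) :
    IsL2 a b ((Ioo c d).indicator x) := by
  rw [IsL2, memLp_indicator_iff_restrict measurableSet_Ioo, Measure.restrict_restrict
    measurableSet_Ioo]
  exact MemLp.mono_measure (Measure.restrict_mono inter_subset_left le_rfl) hx

/-! ### The coupled state–adjoint system on the whole interval. -/

namespace Problem

variable {n m l : ℕ} {S : Problem n m l}

namespace Standing

theorem T_pos (hS : S.Standing) : 0 < S.T :=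
  hS.zero_le_α.trans_lt (hS.α_lt_s.trans (hS.s_lt_β.trans_le hS.β_le_T))

theorem α_lt_β (hS : S.Standing) : S.α < S.β := hS.α_lt_s.trans hS.s_lt_β

theorem s_mem (hS : S.Standing) : S.s ∈ Icc 0 S.T :=
  ⟨hS.zero_le_α.trans hS.α_lt_s.le, hS.s_lt_β.le.trans hS.β_le_T⟩

theorem Icc_subset (hS : S.Standing) : Icc S.α S.β ⊆ Icc 0 S.T :=
  Icc_subset_Icc hS.zero_le_α hS.β_le_T

theorem Q₂_inv_cont (hS : S.Standing) : ContinuousOn (fun t => (S.Q₂ t)⁻¹) (Icc 0 S.T) :=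
  continuousOn_inv_of_posDef hS.Q₂_cont hS.Q₂_posDef

theorem Q_inv_cont (hS : S.Standing) : ContinuousOn (fun t => (S.Q t)⁻¹) (Icc S.α S.β) :=
  continuousOn_inv_of_posDef hS.Q_cont hS.Q_posDef

theorem HQ_cont (hS : S.Standing) : ContinuousOn (fun t => (S.H t)ᵀ * S.Q t) (Icc S.α S.β) :=
  (continuous_fst.matrix_transpose.matrix_mul continuous_snd).comp_continuousOn
    (hS.H_cont.prodMk hS.Q_cont)

theorem QH_cont (hS : S.Standing) : ContinuousOn (fun t => S.Q t * S.H t) (Icc S.α S.β) :=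
  (continuous_fst.matrix_mul continuous_snd).comp_continuousOn (hS.Q_cont.prodMk hS.H_cont)

theorem HQH_cont (hS : S.Standing) :
    ContinuousOn (fun t => (S.H t)ᵀ * S.Q t * S.H t) (Icc S.α S.β) :=
  (continuous_fst.matrix_mul continuous_snd).comp_continuousOn (hS.HQ_cont.prodMk hS.H_cont)

end Standing

/-- The matrix `Hᵀ Q H` on the observation interval, continued by zero. -/
noncomputable def gram (S : Problem n m l) : ℝ → Matrix (Fin n) (Fin n) ℝ :=
  (Ioo S.α S.β).indicator fun t => (S.H t)ᵀ * S.Q t * S.H t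

theorem gram_mulVec (x : ℝ → Fin n → ℝ) :
    (fun t => S.gram t *ᵥ x t)
      = (Ioo S.α S.β).indicator fun t => ((S.H t)ᵀ * S.Q t * S.H t) *ᵥ x t := by
  ext1 t
  by_cases ht : t ∈ Ioo S.α S.β <;> simp [gram, ht]

theorem dotProduct_gram_mulVec {t : ℝ} (ht : t ∈ Ioo S.α S.β) (x y : Fin n → ℝ) :
    x ⬝ᵥ (S.gram t *ᵥ y) = (S.H t *ᵥ x) ⬝ᵥ (S.Q t *ᵥ (S.H t *ᵥ y)) := by
  rw [gram, indicator_of_mem ht, Matrix.mul_assoc, ← Matrix.mulVec_mulVec, Matrix.dotProduct_mulVec,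
    Matrix.vecMul_transpose, Matrix.mulVec_mulVec]

theorem dotProduct_gram_mulVec_nonneg (hS : S.Standing) (t : ℝ) (x : Fin n → ℝ) :
    0 ≤ x ⬝ᵥ (S.gram t *ᵥ x) := by
  by_cases ht : t ∈ Ioo S.α S.β
  · rw [dotProduct_gram_mulVec ht, dotProduct_comm]
    exact (hS.Q_posDef t (Ioo_subset_Icc_self ht)).mulVec_dotProduct_nonneg _
  · simp [gram, ht]

theorem isL2_gram_mulVec (hS : S.Standing) {x : ℝ → Fin n → ℝ} (hx : ContinuousOn x (Icc 0 S.T)) :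
    IsL2 0 S.T fun t => S.gram t *ᵥ x t := by
  rw [gram_mulVec]
  exact isL2_indicator ((ContinuousOn.isL2 (hx.mono hS.Icc_subset)).mulVec hS.HQH_cont)

/-- The coupled system for `(φ, p)` on the whole interval `[0, T]`, with general data. -/
structure SolvesGlobal (S : Problem n m l) (e₀ : Fin m ⊕ Fin (n - m) ≃ Fin n)
    (e₁ : Fin (n - m) ⊕ Fin m ≃ Fin n) (f g : ℝ → Fin n → ℝ) (r₀ : Fin m → ℝ)
    (r₁ : Fin (n - m) → ℝ) (q₁ : Fin m → ℝ) (φ p : ℝ → Fin n → ℝ) : Prop where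
  φ_eq : SolvesL S.A 0 S.T φ fun t => (S.Q₂ t)⁻¹ *ᵥ p t + f t
  p_eq : SolvesLstar S.A 0 S.T p fun t => g t - S.gram t *ᵥ φ t
  p_zero : hatMat e₀ S.B₀ *ᵥ p 0 = 0
  p_T : hatMat e₁ S.B₁ *ᵥ p S.T = q₁
  φ_zero : S.B₀ *ᵥ φ 0 = S.Q₀⁻¹ *ᵥ (barMat e₀ S.B₀ *ᵥ p 0) + r₀
  φ_T : S.B₁ *ᵥ φ S.T = -(S.Q₁⁻¹ *ᵥ (barMat e₁ S.B₁ *ᵥ p S.T)) + r₁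

section System

variable {e₀ : Fin m ⊕ Fin (n - m) ≃ Fin n} {e₁ : Fin (n - m) ⊕ Fin m ≃ Fin n}
  {f g : ℝ → Fin n → ℝ} {r₀ : Fin m → ℝ} {r₁ : Fin (n - m) → ℝ} {q₁ : Fin m → ℝ}
  {φ p φ' p' : ℝ → Fin n → ℝ}

theorem SolvesGlobal.sub (hS : S.Standing) (h : S.SolvesGlobal e₀ e₁ f g r₀ r₁ q₁ φ p)
    (h' : S.SolvesGlobal e₀ e₁ f g r₀ r₁ q₁ φ' p') :
    S.SolvesGlobal e₀ e₁ 0 0 0 0 0 (fun t => φ t - φ' t) (fun t => p t - p' t) where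
  φ_eq := (h.φ_eq.sub hS.T_pos.le h'.φ_eq).congr_rhs <| Filter.Eventually.of_forall fun t => by
    simp [Matrix.mulVec_sub]
  p_eq := (h.p_eq.sub hS.T_pos.le h'.p_eq).congr_rhs <| Filter.Eventually.of_forall fun t => by
    simp [Matrix.mulVec_sub]
  p_zero := by simp [Matrix.mulVec_sub, h.p_zero, h'.p_zero]
  p_T := by simp [Matrix.mulVec_sub, h.p_T, h'.p_T]
  φ_zero := by simp [Matrix.mulVec_sub, h.φ_zero, h'.φ_zero]
  φ_T := by
    simp only [Matrix.mulVec_sub, h.φ_T, h'.φ_T]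
    abel

/-- The homogeneous coupled system has only the trivial solution. -/
theorem SolvesGlobal.eq_zero (hS : S.Standing) (h₀ : (selBlock e₀ S.B₀).det ≠ 0)
    (h₁ : (selBlock e₁ S.B₁).det ≠ 0) (h : S.SolvesGlobal e₀ e₁ 0 0 0 0 0 φ p) :
    ∀ t ∈ Icc 0 S.T, φ t = 0 ∧ p t = 0 := by
  have hT := hS.T_pos
  have hpc := h.p_eq.1.continuousOn hT.le
  -- Energy identity: ∫(Q₂⁻¹p, p) + ∫(HᵀQHφ, φ) + (Q₀⁻¹B̄₀p(0), B̄₀p(0)) + (Q₁⁻¹B̄₁p(T), B̄₁p(T)) =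
  -- 0, with every term nonnegative. The first one forces p = 0 by continuity.
  have hL := h.φ_eq.lagrange hT.le hS.A_cont h.p_eq
  rw [dotProduct_eq_of_hatMat_eq_zero e₁ h₁ h.p_T, dotProduct_eq_of_hatMat_eq_zero e₀ h₀ h.p_zero,
    h.φ_zero, h.φ_T] at hL
  simp only [Pi.zero_apply, add_zero, zero_sub, dotProduct_neg, intervalIntegral.integral_neg,
    sub_neg_eq_add, neg_dotProduct] at hL
  have e1 := hS.Q₁_posDef.inv.mulVec_dotProduct_nonneg (barMat e₁ S.B₁ *ᵥ p S.T)
  have e2 := hS.Q₀_posDef.inv.mulVec_dotProduct_nonneg (barMat e₀ S.B₀ *ᵥ p 0)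
  have e3 : 0 ≤ ∫ t in (0 : ℝ)..S.T, φ t ⬝ᵥ (S.gram t *ᵥ φ t) :=
    intervalIntegral.integral_nonneg hT.le fun t _ => dotProduct_gram_mulVec_nonneg hS t _
  have hp : ∀ t ∈ Icc 0 S.T, p t = 0 := by
    by_contra! hne
    obtain ⟨t, ht, hpt⟩ := hne
    have e4 : 0 < ∫ t in (0 : ℝ)..S.T, ((S.Q₂ t)⁻¹ *ᵥ p t) ⬝ᵥ p t := by
      refine intervalIntegral.integral_pos hT ?_ (fun τ hτ => ?_) ⟨t, ht, ?_⟩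
      · exact continuousOn_dotProduct (continuousOn_mulVec hS.Q₂_inv_cont hpc) hpc
      · exact (hS.Q₂_posDef τ ⟨hτ.1.le, hτ.2⟩).inv.mulVec_dotProduct_nonneg _
      · exact (hS.Q₂_posDef t ht).inv.mulVec_dotProduct_pos hpt
    linarith
  have hφ : S.SolvesBVP ⟨0, 0, 0⟩ φ := by
    refine ⟨h.φ_eq.congr_rhs (ae_restrict_of_forall_mem_Ioo fun t ht => ?_), ?_, ?_⟩
    · simp [hp t (Ioo_subset_Icc_self ht)]
    · simp [h.φ_zero, hp 0 ⟨le_rfl, hT.le⟩]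
    · simp [h.φ_T, hp S.T ⟨hT.le, le_rfl⟩]
  exact fun t ht => ⟨hS.homogeneous φ hφ t ht, hp t ht⟩

theorem SolvesGlobal.unique (hS : S.Standing) (h₀ : (selBlock e₀ S.B₀).det ≠ 0)
    (h₁ : (selBlock e₁ S.B₁).det ≠ 0) (h : S.SolvesGlobal e₀ e₁ f g r₀ r₁ q₁ φ p)
    (h' : S.SolvesGlobal e₀ e₁ f g r₀ r₁ q₁ φ' p') :
    EqOn φ φ' (Icc 0 S.T) ∧ EqOn p p' (Icc 0 S.T) :=
  ⟨fun t ht => sub_eq_zero.1 ((h.sub hS h').eq_zero hS h₀ h₁ t ht).1,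
    fun t ht => sub_eq_zero.1 ((h.sub hS h').eq_zero hS h₀ h₁ t ht).2⟩

theorem IsL2.integrableOn_Icc {k : ℕ} {a b : ℝ} {x : ℝ → Fin k → ℝ} (hx : IsL2 a b x) (i : Fin k) :
    IntegrableOn (fun t => x t i) (Icc a b) := by
  rw [integrableOn_Icc_iff_integrableOn_Ioo]
  exact (isL2_iff.1 hx i).integrable (by norm_num)

/-- Fredholm alternative with m + (n − m) = n boundary conditions; the uniqueness it needs is the
standing assumption. -/
theorem exists_solvesBVP (hS : S.Standing) (F : Rhs n m) (hF : IsL2 0 S.T F.f) :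
    ∃ φ, S.SolvesBVP F φ := by
  have hmn := hS.m_le
  have hT := hS.T_pos
  obtain ⟨x, hxc, hx, hr⟩ := exists_matrix_boundaryValue_solution (ι := Fin n)
    (E' := (Fin m → ℝ) × (Fin (n - m) → ℝ)) (M := fun t => -(S.A t)) (g := F.f)
    (by simp; omega) hT.le (ContinuousOn.isBoundedMeasurable hS.A_cont.neg)
    (S.B₀.mulVecLin.prod 0) (LinearMap.prod 0 S.B₁.mulVecLin)
    (fun x hxc hx hbd => hS.homogeneous x (by
      rw [prod_zero_apply_add_zero_prod_apply, Prod.mk_eq_zero] at hbd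
      refine ⟨solvesL_of_integral hT.le hS.A_cont MemLp.zero hxc fun t ht i => ?_, hbd⟩
      simpa [Matrix.neg_mulVec] using hx t ht i) 0 ⟨le_rfl, hT.le⟩)
    (fun i => IsL2.integrableOn_Icc hF i) (F.f₀, F.f₁)
  rw [prod_zero_apply_add_zero_prod_apply, Prod.mk.injEq] at hr
  refine ⟨x, solvesL_of_integral hT.le hS.A_cont hF hxc fun t ht i => ?_, hr⟩
  simpa [Matrix.neg_mulVec, sub_eq_add_neg] using hx t ht i

/-- The pair (φ, p) is stacked into one system in ℝ²ⁿ: φ' = −Aφ + Q₂⁻¹p + f and p' = HᵀQHφ + Aᵀp −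
g. -/
theorem solvesGlobal_of_integral (hS : S.Standing) (hf : IsL2 0 S.T f) (hg : IsL2 0 S.T g)
    {x : ℝ → Fin n ⊕ Fin n → ℝ} (hxc : ContinuousOn x (Icc 0 S.T))
    (hx : ∀ t ∈ Icc 0 S.T, ∀ i, x t i = x 0 i + ∫ τ in (0 : ℝ)..t, (Sum.elim (f τ) (-g τ) i
      + (Matrix.fromBlocks (-(S.A τ)) (S.Q₂ τ)⁻¹ (S.gram τ) (S.A τ)ᵀ *ᵥ x τ) i))
    (b1 : S.B₀ *ᵥ (x 0 ∘ Sum.inl) - S.Q₀⁻¹ *ᵥ (barMat e₀ S.B₀ *ᵥ (x 0 ∘ Sum.inr)) = r₀)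
    (b2 : hatMat e₀ S.B₀ *ᵥ (x 0 ∘ Sum.inr) = 0)
    (b3 : S.B₁ *ᵥ (x S.T ∘ Sum.inl) + S.Q₁⁻¹ *ᵥ (barMat e₁ S.B₁ *ᵥ (x S.T ∘ Sum.inr)) = r₁)
    (b4 : hatMat e₁ S.B₁ *ᵥ (x S.T ∘ Sum.inr) = q₁) :
    S.SolvesGlobal e₀ e₁ f g r₀ r₁ q₁ (fun t => x t ∘ Sum.inl) (fun t => x t ∘ Sum.inr) := by
  have hT := hS.T_pos
  have c1 : ContinuousOn (fun t => x t ∘ Sum.inl) (Icc 0 S.T) :=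
    continuousOn_pi.2 fun i => (continuous_apply (Sum.inl i)).comp_continuousOn hxc
  have c2 : ContinuousOn (fun t => x t ∘ Sum.inr) (Icc 0 S.T) :=
    continuousOn_pi.2 fun i => (continuous_apply (Sum.inr i)).comp_continuousOn hxc
  refine ⟨?_, ?_, b2, b4, ?_, ?_⟩
  · refine solvesL_of_integral hT.le hS.A_cont
      (((ContinuousOn.isL2 c2).mulVec hS.Q₂_inv_cont).add hf) c1 fun t ht i => ?_
    refine (hx t ht (Sum.inl i)).trans ?_
    congr 1
    refine intervalIntegral.integral_congr fun τ _ => ?_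
    simp only [Matrix.fromBlocks_mulVec, Sum.elim_inl, Matrix.neg_mulVec, Pi.add_apply,
      Pi.sub_apply, Pi.neg_apply]
    ring
  · refine solvesLstar_iff.2 (solvesL_of_integral hT.le (continuousOn_neg_transpose hS.A_cont)
      (MemLp.neg (hg.sub (isL2_gram_mulVec hS c1))) c2 fun t ht i => ?_)
    refine (hx t ht (Sum.inr i)).trans ?_
    congr 1
    refine intervalIntegral.integral_congr fun τ _ => ?_
    simp only [Matrix.fromBlocks_mulVec, Sum.elim_inr, Matrix.neg_mulVec, Pi.add_apply,
      Pi.sub_apply, Pi.neg_apply]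
    ring
  · rw [← b1]
    abel
  · rw [← b3]
    abel

/-- There are n conditions at each end, 2n in all, as many as unknowns; uniqueness is the energy
identity `SolvesGlobal.eq_zero`. -/
theorem exists_solvesGlobal (hS : S.Standing) (h₀ : (selBlock e₀ S.B₀).det ≠ 0)
    (h₁ : (selBlock e₁ S.B₁).det ≠ 0) (hf : IsL2 0 S.T f) (hg : IsL2 0 S.T g) (r₀ : Fin m → ℝ)
    (r₁ : Fin (n - m) → ℝ) (q₁ : Fin m → ℝ) : ∃ φ p, S.SolvesGlobal e₀ e₁ f g r₀ r₁ q₁ φ p := by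
  have hmn := hS.m_le
  have hT := hS.T_pos
  let X : (Fin n ⊕ Fin n → ℝ) →ₗ[ℝ] (Fin n → ℝ) := LinearMap.funLeft ℝ ℝ Sum.inl
  let Y : (Fin n ⊕ Fin n → ℝ) →ₗ[ℝ] (Fin n → ℝ) := LinearMap.funLeft ℝ ℝ Sum.inr
  let U : (Fin n ⊕ Fin n → ℝ) →ₗ[ℝ] ((Fin m → ℝ) × (Fin (n - m) → ℝ)) :=
    (S.B₀.mulVecLin ∘ₗ X - S.Q₀⁻¹.mulVecLin ∘ₗ (barMat e₀ S.B₀).mulVecLin ∘ₗ Y).prod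
      ((hatMat e₀ S.B₀).mulVecLin ∘ₗ Y)
  let V : (Fin n ⊕ Fin n → ℝ) →ₗ[ℝ] ((Fin (n - m) → ℝ) × (Fin m → ℝ)) :=
    (S.B₁.mulVecLin ∘ₗ X + S.Q₁⁻¹.mulVecLin ∘ₗ (barMat e₁ S.B₁).mulVecLin ∘ₗ Y).prod
      ((hatMat e₁ S.B₁).mulVecLin ∘ₗ Y)
  have hM : IsBoundedMeasurable S.T fun t =>
      Matrix.fromBlocks (-(S.A t)) (S.Q₂ t)⁻¹ (S.gram t) (S.A t)ᵀ := by
    rintro (i | i) (j | j)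
    · exact ContinuousOn.isBoundedMeasurable hS.A_cont.neg i j
    · exact ContinuousOn.isBoundedMeasurable hS.Q₂_inv_cont i j
    · exact isBoundedMeasurable_indicator hS.HQH_cont i j
    · exact ContinuousOn.isBoundedMeasurable hS.A_cont j i
  have hUV : ∀ {a b : Fin n ⊕ Fin n → ℝ} {s₀ s₁ s₂ s₃},
      LinearMap.prod U 0 a + LinearMap.prod 0 V b = ((s₀, s₁), (s₂, s₃)) →
      (S.B₀ *ᵥ (a ∘ Sum.inl) - S.Q₀⁻¹ *ᵥ (barMat e₀ S.B₀ *ᵥ (a ∘ Sum.inr)) = s₀ ∧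
        hatMat e₀ S.B₀ *ᵥ (a ∘ Sum.inr) = s₁) ∧
      (S.B₁ *ᵥ (b ∘ Sum.inl) + S.Q₁⁻¹ *ᵥ (barMat e₁ S.B₁ *ᵥ (b ∘ Sum.inr)) = s₂ ∧
        hatMat e₁ S.B₁ *ᵥ (b ∘ Sum.inr) = s₃) := by
    intro a b s₀ s₁ s₂ s₃ h
    rw [prod_zero_apply_add_zero_prod_apply, Prod.mk.injEq] at h
    obtain ⟨hU, hV⟩ := h
    exact ⟨Prod.mk.inj hU, Prod.mk.inj hV⟩
  obtain ⟨x, hxc, hx, hr⟩ := exists_matrix_boundaryValue_solution (ι := Fin n ⊕ Fin n)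
    (g := fun t => Sum.elim (f t) (-g t)) (by simp; omega) hT.le hM (U.prod 0) (LinearMap.prod 0 V)
    (fun x hxc hx hbd => by
      obtain ⟨⟨b1, b2⟩, b3, b4⟩ := hUV (s₀ := 0) (s₁ := 0) (s₂ := 0) (s₃ := 0) hbd
      have := (solvesGlobal_of_integral hS (f := 0) (g := 0) MemLp.zero MemLp.zero hxc
        (fun t ht i => by
          refine (hx t ht i).trans ?_
          congr 1
          refine intervalIntegral.integral_congr fun τ _ => ?_
          rcases i with i | i <;> simp) b1 b2 b3 b4).eq_zero hS h₀ h₁ 0 ⟨le_rfl, hT.le⟩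
      ext (i | i)
      · exact congrFun this.1 i
      · exact congrFun this.2 i)
    (by
      rintro (i | i)
      · exact IsL2.integrableOn_Icc hf i
      · exact (IsL2.integrableOn_Icc hg i).neg)
    ((r₀, 0), (r₁, q₁))
  obtain ⟨⟨b1, b2⟩, b3, b4⟩ := hUV hr
  exact ⟨_, _, solvesGlobal_of_integral hS hf hg hxc hx b1 b2 b3 b4⟩

end System

end Problem

/-! ### Integrals of functions continued by zero. -/

theorem intervalIntegral_indicator_Ioo {f : ℝ → ℝ} {a b c d : ℝ} (hac : a ≤ c) (hcd : c ≤ d)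
    (hdb : d ≤ b) : ∫ t in a..b, (Ioo c d).indicator f t = ∫ t in c..d, f t := by
  rw [intervalIntegral_eq_Ioo (hac.trans (hcd.trans hdb)), intervalIntegral_eq_Ioo hcd,
    integral_indicator measurableSet_Ioo, Measure.restrict_restrict measurableSet_Ioo,
    inter_eq_left.2 (Ioo_subset_Ioo hac hdb)]

theorem intervalIntegral_dotProduct_indicator_Ioo {k : ℕ} {x y : ℝ → Fin k → ℝ} {a b c d : ℝ}
    (hac : a ≤ c) (hcd : c ≤ d) (hdb : d ≤ b) :
    ∫ t in a..b, x t ⬝ᵥ (Ioo c d).indicator y t = ∫ t in c..d, x t ⬝ᵥ y t := by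
  rw [← intervalIntegral_indicator_Ioo hac hcd hdb]
  congr 1
  ext1 t
  by_cases ht : t ∈ Ioo c d <;> simp [ht]

namespace Problem

variable {n m l : ℕ} {S : Problem n m l}

/-! ### Gluing the four pieces -/

/-- The function on `[0, T]` glued from four pieces. -/
noncomputable def glue (S : Problem n m l) (x : Fin 4 → ℝ → Fin n → ℝ) (t : ℝ) : Fin n → ℝ :=
  if t ≤ S.α then x 0 t else if t ≤ S.s then x 1 t else if t ≤ S.β then x 2 t else x 3 t

/-- At a junction `glue` takes the left-hand piece, so the matching conditions are what makes it
agree with the right-hand piece there. -/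
theorem samePieces_glue (hS : S.Standing) {x : Fin 4 → ℝ → Fin n → ℝ} (hα : x 1 S.α = x 0 S.α)
    (hs : x 2 S.s = x 1 S.s) (hβ : x 3 S.β = x 2 S.β) : S.SamePieces x fun _ => S.glue x := by
  have h1 := hS.α_lt_s
  have h2 := hS.s_lt_β
  refine ⟨fun t ht => ?_, fun t ht => ?_, fun t ht => ?_, fun t ht => ?_⟩
  · simp [glue, ht.2]
  · rcases ht.1.eq_or_lt with rfl | h
    · simp [glue, hα]
    · simp [glue, h.not_ge, ht.2]
  · rcases ht.1.eq_or_lt with rfl | h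
    · simp [glue, hs, h1]
    · simp [glue, (h1.trans h).not_ge, h.not_ge, ht.2]
  · rcases ht.1.eq_or_lt with rfl | h
    · simp [glue, hβ, (h1.trans h2).not_ge, h2.not_ge]
    · simp [glue, (h1.trans (h2.trans h)).not_ge, (h2.trans h).not_ge, h.not_ge]

theorem solvesL_of_pieces (hS : S.Standing) {x g : ℝ → Fin n → ℝ}
    (h1 : SolvesL S.A 0 S.α x g) (h2 : SolvesL S.A S.α S.s x g) (h3 : SolvesL S.A S.s S.β x g)
    (h4 : SolvesL S.A S.β S.T x g) : SolvesL S.A 0 S.T x g := by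
  have e0 := hS.zero_le_α
  have e1 := hS.α_lt_s.le
  have e2 := hS.s_lt_β.le
  have e3 := hS.β_le_T
  have hA : ∀ t, t ≤ S.T → ContinuousOn S.A (Icc 0 t) := fun t ht =>
    hS.A_cont.mono (Icc_subset_Icc_right ht)
  exact SolvesL.glue (e0.trans (e1.trans e2)) e3 hS.A_cont (SolvesL.glue (e0.trans e1) e2 (hA _ e3)
    (SolvesL.glue e0 e1 (hA _ (e2.trans e3)) h1 h2) h3) h4

theorem solvesLstar_of_pieces (hS : S.Standing) {x g : ℝ → Fin n → ℝ}
    (h1 : SolvesLstar S.A 0 S.α x g) (h2 : SolvesLstar S.A S.α S.s x g)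
    (h3 : SolvesLstar S.A S.s S.β x g) (h4 : SolvesLstar S.A S.β S.T x g) :
    SolvesLstar S.A 0 S.T x g := by
  have e0 := hS.zero_le_α
  have e1 := hS.α_lt_s.le
  have e2 := hS.s_lt_β.le
  have e3 := hS.β_le_T
  have hA : ∀ t, t ≤ S.T → ContinuousOn S.A (Icc 0 t) := fun t ht =>
    hS.A_cont.mono (Icc_subset_Icc_right ht)
  exact SolvesLstar.glue (e0.trans (e1.trans e2)) e3 hS.A_cont
    (SolvesLstar.glue (e0.trans e1) e2 (hA _ e3)
      (SolvesLstar.glue e0 e1 (hA _ (e2.trans e3)) h1 h2) h3) h4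

/-- The observation `y` as a source term of the adjoint equation. -/
noncomputable def source (S : Problem n m l) (y : ℝ → Fin l → ℝ) : ℝ → Fin n → ℝ :=
  (Ioo S.α S.β).indicator fun t => ((S.H t)ᵀ * S.Q t) *ᵥ y t

theorem isL2_source (hS : S.Standing) {y : ℝ → Fin l → ℝ} (hy : IsL2 S.α S.β y) :
    IsL2 0 S.T (S.source y) :=
  isL2_indicator (hy.mulVec hS.HQ_cont)

theorem source_sub_gram_of_mem {t : ℝ} (ht : t ∈ Ioo S.α S.β) (y : ℝ → Fin l → ℝ)
    (v : Fin n → ℝ) :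
    S.source y t - S.gram t *ᵥ v = ((S.H t)ᵀ * S.Q t) *ᵥ (y t - S.H t *ᵥ v) := by
  simp [source, gram, ht, Matrix.mulVec_sub]

theorem source_sub_gram_of_notMem {t : ℝ} (ht : t ∉ Ioo S.α S.β) (y : ℝ → Fin l → ℝ)
    (v : Fin n → ℝ) : S.source y t - S.gram t *ᵥ v = 0 := by
  simp [source, gram, ht]

section System

variable {e₀ : Fin m ⊕ Fin (n - m) ≃ Fin n} {e₁ : Fin (n - m) ⊕ Fin m ≃ Fin n}
  {y : ℝ → Fin l → ℝ}

/-- On each open piece the source and HᵀQH, both continued by zero, reproduce the right-hand sides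
of the four adjoint equations; the junctions are null sets. -/
theorem SolvesSystem.solvesGlobal (hS : S.Standing) {p φ : Fin 4 → ℝ → Fin n → ℝ}
    (h : S.SolvesSystem e₀ e₁ y p φ) :
    S.SolvesGlobal e₀ e₁ S.centre.f (S.source y) S.centre.f₀ S.centre.f₁ 0 (S.glue φ)
      (S.glue p) := by
  have e0 := hS.zero_le_α
  have e1 := hS.α_lt_s.le
  have e2 := hS.s_lt_β.le
  have e3 := hS.β_le_T
  obtain ⟨a1, a2, a3, a4⟩ := samePieces_glue hS h.φ_α h.φ_s h.φ_β
  obtain ⟨b1, b2, b3, b4⟩ := samePieces_glue hS h.p_α h.p_s h.p_β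
  beta_reduce at a1 a2 a3 a4 b1 b2 b3 b4
  refine ⟨solvesL_of_pieces hS ?_ ?_ ?_ ?_, solvesLstar_of_pieces hS ?_ ?_ ?_ ?_, ?_, ?_, ?_, ?_⟩
  · refine (h.φ₁.congr e0 a1).congr_rhs (ae_restrict_of_forall_mem_Ioo fun t ht => ?_)
    rw [b1 (Ioo_subset_Icc_self ht)]
  · refine (h.φ₂.congr e1 a2).congr_rhs (ae_restrict_of_forall_mem_Ioo fun t ht => ?_)
    rw [b2 (Ioo_subset_Icc_self ht)]
  · refine (h.φ₃.congr e2 a3).congr_rhs (ae_restrict_of_forall_mem_Ioo fun t ht => ?_)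
    rw [b3 (Ioo_subset_Icc_self ht)]
  · refine (h.φ₄.congr e3 a4).congr_rhs (ae_restrict_of_forall_mem_Ioo fun t ht => ?_)
    rw [b4 (Ioo_subset_Icc_self ht)]
  · refine (h.p₁.congr e0 b1).congr_rhs (ae_restrict_of_forall_mem_Ioo fun t ht => ?_)
    rw [source_sub_gram_of_notMem fun h' => h'.1.not_gt ht.2, Pi.zero_apply]
  · refine (h.p₂.congr e1 b2).congr_rhs (ae_restrict_of_forall_mem_Ioo fun t ht => ?_)
    rw [source_sub_gram_of_mem ⟨ht.1, ht.2.trans_le e2⟩, a2 (Ioo_subset_Icc_self ht)]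
  · refine (h.p₃.congr e2 b3).congr_rhs (ae_restrict_of_forall_mem_Ioo fun t ht => ?_)
    rw [source_sub_gram_of_mem ⟨e1.trans_lt ht.1, ht.2⟩, a3 (Ioo_subset_Icc_self ht)]
  · refine (h.p₄.congr e3 b4).congr_rhs (ae_restrict_of_forall_mem_Ioo fun t ht => ?_)
    rw [source_sub_gram_of_notMem fun h' => h'.2.not_gt ht.1, Pi.zero_apply]
  · rw [← b1 (left_mem_Icc.2 e0), h.p_zero]
  · rw [← b4 (right_mem_Icc.2 e3), h.p_T]
  · rw [← a1 (left_mem_Icc.2 e0), ← b1 (left_mem_Icc.2 e0), h.φ_zero]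
  · rw [← a4 (right_mem_Icc.2 e3), ← b4 (right_mem_Icc.2 e3), h.φ_T]

theorem SolvesGlobal.solvesSystem (hS : S.Standing) {p φ : ℝ → Fin n → ℝ}
    (h : S.SolvesGlobal e₀ e₁ S.centre.f (S.source y) S.centre.f₀ S.centre.f₁ 0 φ p) :
    S.SolvesSystem e₀ e₁ y (fun _ => p) fun _ => φ := by
  have e0 := hS.zero_le_α
  have e1 := hS.α_lt_s.le
  have e2 := hS.s_lt_β.le
  have e3 := hS.β_le_T
  refine ⟨?_, ?_, ?_, ?_, h.p_zero, rfl, rfl, rfl, h.p_T,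
    h.φ_eq.mono le_rfl e0 (e1.trans (e2.trans e3)), h.φ_eq.mono e0 e1 (e2.trans e3),
    h.φ_eq.mono (e0.trans e1) e2 e3, h.φ_eq.mono (e0.trans (e1.trans e2)) e3 le_rfl, h.φ_zero,
    rfl, rfl, rfl, h.φ_T⟩
  · refine (h.p_eq.mono le_rfl e0 (e1.trans (e2.trans e3))).congr_rhs
      (ae_restrict_of_forall_mem_Ioo fun t ht => ?_)
    exact source_sub_gram_of_notMem (fun h' => h'.1.not_gt ht.2) _ _
  · refine (h.p_eq.mono e0 e1 (e2.trans e3)).congr_rhs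
      (ae_restrict_of_forall_mem_Ioo fun t ht => ?_)
    exact source_sub_gram_of_mem ⟨ht.1, ht.2.trans_le e2⟩ _ _
  · refine (h.p_eq.mono (e0.trans e1) e2 e3).congr_rhs
      (ae_restrict_of_forall_mem_Ioo fun t ht => ?_)
    exact source_sub_gram_of_mem ⟨e1.trans_lt ht.1, ht.2⟩ _ _
  · refine (h.p_eq.mono (e0.trans (e1.trans e2)) e3 le_rfl).congr_rhs
      (ae_restrict_of_forall_mem_Ioo fun t ht => ?_)
    exact source_sub_gram_of_notMem (fun h' => h'.2.not_gt ht.1) _ _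

theorem exists_solvesSystem (hS : S.Standing) (h₀ : (selBlock e₀ S.B₀).det ≠ 0)
    (h₁ : (selBlock e₁ S.B₁).det ≠ 0) (hy : IsL2 S.α S.β y) :
    ∃ p φ, S.SolvesSystem e₀ e₁ y p φ := by
  obtain ⟨φ, p, h⟩ := exists_solvesGlobal hS h₀ h₁ hS.centre_L2 (isL2_source hS hy) S.centre.f₀
    S.centre.f₁ 0
  exact ⟨_, _, h.solvesSystem hS⟩

theorem samePieces_of_glue (hS : S.Standing) {x x' : Fin 4 → ℝ → Fin n → ℝ}
    (h : S.SamePieces x fun _ => S.glue x) (h' : S.SamePieces x' fun _ => S.glue x')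
    (hg : EqOn (S.glue x) (S.glue x') (Icc 0 S.T)) : S.SamePieces x x' := by
  have e0 := hS.zero_le_α
  have e1 := hS.α_lt_s.le
  have e2 := hS.s_lt_β.le
  have e3 := hS.β_le_T
  refine ⟨h.1.trans ((hg.mono ?_).trans h'.1.symm), h.2.1.trans ((hg.mono ?_).trans h'.2.1.symm),
    h.2.2.1.trans ((hg.mono ?_).trans h'.2.2.1.symm),
    h.2.2.2.trans ((hg.mono ?_).trans h'.2.2.2.symm)⟩
  · exact Icc_subset_Icc le_rfl (e1.trans (e2.trans e3))
  · exact Icc_subset_Icc e0 (e2.trans e3)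
  · exact Icc_subset_Icc (e0.trans e1) e3
  · exact Icc_subset_Icc (e0.trans (e1.trans e2)) le_rfl

theorem SolvesSystem.unique (hS : S.Standing) (h₀ : (selBlock e₀ S.B₀).det ≠ 0)
    (h₁ : (selBlock e₁ S.B₁).det ≠ 0) {p φ p' φ' : Fin 4 → ℝ → Fin n → ℝ}
    (h : S.SolvesSystem e₀ e₁ y p φ) (h' : S.SolvesSystem e₀ e₁ y p' φ') :
    S.SamePieces p p' ∧ S.SamePieces φ φ' := by
  obtain ⟨a, b⟩ := (h.solvesGlobal hS).unique hS h₀ h₁ (h'.solvesGlobal hS)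
  exact ⟨samePieces_of_glue hS (samePieces_glue hS h.p_α h.p_s h.p_β)
      (samePieces_glue hS h'.p_α h'.p_s h'.p_β) b,
    samePieces_of_glue hS (samePieces_glue hS h.φ_α h.φ_s h.φ_β)
      (samePieces_glue hS h'.φ_α h'.φ_s h'.φ_β) a⟩

end System

/-! ### Duality -/

/-- The bilinear form on the right-hand sides that defines the ellipsoid `G`. -/
noncomputable def form (S : Problem n m l) (F F' : Rhs n m) : ℝ :=
  (S.Q₀ *ᵥ F.f₀) ⬝ᵥ F'.f₀ + (S.Q₁ *ᵥ F.f₁) ⬝ᵥ F'.f₁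
    + ∫ t in (0 : ℝ)..S.T, (S.Q₂ t *ᵥ F.f t) ⬝ᵥ F'.f t

/-- The linear combination `F + r F'` of right-hand sides. -/
def _root_.BVPEstimation.Rhs.addSmul (F : Rhs n m) (r : ℝ) (F' : Rhs n m) : Rhs n m :=
  ⟨F.f₀ + r • F'.f₀, F.f₁ + r • F'.f₁, fun t => F.f t + r • F'.f t⟩

theorem SolvesBVP.addSmul (hS : S.Standing) {F F' : Rhs n m} {φ φ' : ℝ → Fin n → ℝ}
    (h : S.SolvesBVP F φ) (r : ℝ) (h' : S.SolvesBVP F' φ') :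
    S.SolvesBVP (F.addSmul r F') fun t => φ t + r • φ' t :=
  ⟨h.1.add_smul hS.T_pos.le r h'.1,
    by simp [Matrix.mulVec_add, Matrix.mulVec_smul, h.2.1, h'.2.1, Rhs.addSmul],
    by simp [Matrix.mulVec_add, Matrix.mulVec_smul, h.2.2, h'.2.2, Rhs.addSmul]⟩

theorem SolvesBVP.continuousOn (hS : S.Standing) {F : Rhs n m} {φ : ℝ → Fin n → ℝ}
    (h : S.SolvesBVP F φ) : ContinuousOn φ (Icc 0 S.T) :=
  h.1.1.continuousOn hS.T_pos.le

theorem SolvesBVP.isL2 (hS : S.Standing) {F : Rhs n m} {φ : ℝ → Fin n → ℝ}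
    (h : S.SolvesBVP F φ) : IsL2 0 S.T F.f :=
  SolvesL.isL2 hS.T_pos.le hS.A_cont h.1

theorem isL2_H_mulVec (hS : S.Standing) {φ : ℝ → Fin n → ℝ} (hφ : ContinuousOn φ (Icc 0 S.T)) :
    IsL2 S.α S.β fun t => S.H t *ᵥ φ t :=
  ContinuousOn.isL2 (continuousOn_mulVec hS.H_cont (hφ.mono hS.Icc_subset))

theorem isL2_QH_mulVec (hS : S.Standing) {φ : ℝ → Fin n → ℝ} (hφ : ContinuousOn φ (Icc 0 S.T)) :
    IsL2 S.α S.β fun t => (S.Q t * S.H t) *ᵥ φ t :=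
  ContinuousOn.isL2 (continuousOn_mulVec hS.QH_cont (hφ.mono hS.Icc_subset))

theorem QH_mulVec_dotProduct (hS : S.Standing) {t : ℝ} (ht : t ∈ Ioo S.α S.β) (x : Fin n → ℝ)
    (z : Fin l → ℝ) :
    ((S.Q t * S.H t) *ᵥ x) ⬝ᵥ z = x ⬝ᵥ (((S.H t)ᵀ * S.Q t) *ᵥ z) := by
  rw [← Matrix.mulVec_mulVec, (hS.Q_posDef t (Ioo_subset_Icc_self ht)).mulVec_dotProduct_comm,
    ← Matrix.mulVec_mulVec, Matrix.dotProduct_mulVec x, Matrix.vecMul_transpose, dotProduct_comm]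

/-- `ψ`, the solution with right-hand side `D`, represents the functional
`φ ↦ (a, φ(s)) - ∫ (Q H ψ, H φ)` in the form of the ellipsoid. -/
structure Represents (S : Problem n m l) (a : Fin n → ℝ) (D : Rhs n m) (ψ : ℝ → Fin n → ℝ) :
    Prop where
  solves : S.SolvesBVP D ψ
  rep : ∀ F φ, S.SolvesBVP F φ →
    a ⬝ᵥ φ S.s - (∫ t in S.α..S.β, ((S.Q t * S.H t) *ᵥ ψ t) ⬝ᵥ (S.H t *ᵥ φ t)) = S.form D F

section Duality

variable {e₀ : Fin m ⊕ Fin (n - m) ≃ Fin n} {e₁ : Fin (n - m) ⊕ Fin m ≃ Fin n}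
  {a : Fin n → ℝ} {D : Rhs n m} {ψ : ℝ → Fin n → ℝ}

theorem exists_represents (hS : S.Standing) (h₀ : (selBlock e₀ S.B₀).det ≠ 0)
    (h₁ : (selBlock e₁ S.B₁).det ≠ 0) (a : Fin n → ℝ) : ∃ D ψ, S.Represents a D ψ := by
  have hT := hS.T_pos.le
  have hsT := hS.s_mem
  -- The dual adjoint function p should jump by −a at s. With κ = a on (s, T) and 0 elsewhere, P = p
  -- + κ is continuous; the price is the extra sources −Q₂⁻¹κ and Aᵀκ and the shifted data at T.
  have hκ : IsL2 0 S.T ((Ioo S.s S.T).indicator fun _ => a) :=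
    isL2_indicator (ContinuousOn.isL2 continuousOn_const)
  have hAa : IsL2 S.s S.T fun t => (S.A t)ᵀ *ᵥ a := by
    refine ContinuousOn.isL2 (continuousOn_mulVec ?_ continuousOn_const)
    exact (Continuous.matrix_transpose continuous_id).comp_continuousOn
      (hS.A_cont.mono (Icc_subset_Icc_left hsT.1))
  have hg := isL2_indicator (a := 0) (b := S.T) hAa
  have hf : IsL2 0 S.T fun t => -(S.Q₂ t)⁻¹ *ᵥ (Ioo S.s S.T).indicator (fun _ => a) t :=
    hκ.mulVec hS.Q₂_inv_cont.neg
  obtain ⟨ψ, P, h⟩ := exists_solvesGlobal hS h₀ h₁ hf hg 0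
    (S.Q₁⁻¹ *ᵥ (barMat e₁ S.B₁ *ᵥ a)) (hatMat e₁ S.B₁ *ᵥ a)
  refine ⟨⟨_, _, _⟩, ψ, ⟨h.φ_eq, h.φ_zero, h.φ_T⟩, fun F φ hφ => ?_⟩
  have hφc := hφ.continuousOn hS
  have hψc := h.φ_eq.1.continuousOn hT
  have hPc := h.p_eq.1.continuousOn hT
  have hF := hφ.isL2 hS
  have hφ2 := ContinuousOn.isL2 hφc
  have hP2 := ContinuousOn.isL2 hPc
  have hL := hφ.1.lagrange hT hS.A_cont h.p_eq
  -- Lagrange's identity on (s, T) with the constant function a is what produces the point value (a,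
  -- φ(s)).
  have hconst : SolvesLstar S.A S.s S.T (fun _ => a) fun t => (S.A t)ᵀ *ᵥ a := by
    refine ⟨fun i => ⟨(LipschitzWith.const (a i)).lipschitzOnWith.absolutelyContinuousOnInterval,
      by simp⟩, Filter.Eventually.of_forall fun t => ?_⟩
    ext i
    simp [opLstar]
  have hL' := (hφ.1.mono hsT.1 hsT.2 le_rfl).lagrange hsT.2
    (hS.A_cont.mono (Icc_subset_Icc_left hsT.1)) hconst
  have hb1 : φ S.T ⬝ᵥ P S.T - φ S.T ⬝ᵥ a
      = F.f₁ ⬝ᵥ (barMat e₁ S.B₁ *ᵥ P S.T) - F.f₁ ⬝ᵥ (barMat e₁ S.B₁ *ᵥ a) := by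
    have : hatMat e₁ S.B₁ *ᵥ (P S.T - a) = 0 := by rw [Matrix.mulVec_sub, h.p_T, sub_self]
    rw [← dotProduct_sub, dotProduct_eq_of_hatMat_eq_zero e₁ h₁ this, hφ.2.2, Matrix.mulVec_sub,
      dotProduct_sub]
  have hb0 : φ 0 ⬝ᵥ P 0 = F.f₀ ⬝ᵥ (barMat e₀ S.B₀ *ᵥ P 0) := by
    rw [dotProduct_eq_of_hatMat_eq_zero e₀ h₀ h.p_zero, hφ.2.1]
  have hi1 : ∫ t in (0 : ℝ)..S.T, φ t ⬝ᵥ ((Ioo S.s S.T).indicator (fun t => (S.A t)ᵀ *ᵥ a) t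
        - S.gram t *ᵥ ψ t)
      = (∫ t in S.s..S.T, φ t ⬝ᵥ ((S.A t)ᵀ *ᵥ a))
        - ∫ t in S.α..S.β, ((S.Q t * S.H t) *ᵥ ψ t) ⬝ᵥ (S.H t *ᵥ φ t) := by
    simp only [dotProduct_sub]
    rw [intervalIntegral.integral_sub (hφ2.intervalIntegrable_dotProduct hT hg)
      (hφ2.intervalIntegrable_dotProduct hT (isL2_gram_mulVec hS hψc)),
      intervalIntegral_dotProduct_indicator_Ioo hsT.1 hsT.2 le_rfl]
    congr 1
    rw [← intervalIntegral_indicator_Ioo hS.zero_le_α hS.α_lt_β.le hS.β_le_T]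
    congr 1
    ext1 t
    by_cases ht : t ∈ Ioo S.α S.β
    · rw [indicator_of_mem ht, dotProduct_gram_mulVec ht, ← Matrix.mulVec_mulVec, dotProduct_comm]
    · simp [gram, ht]
  have hi2 : ∫ t in (0 : ℝ)..S.T, (S.Q₂ t *ᵥ ((S.Q₂ t)⁻¹ *ᵥ P t
        + -(S.Q₂ t)⁻¹ *ᵥ (Ioo S.s S.T).indicator (fun _ => a) t)) ⬝ᵥ F.f t
      = (∫ t in (0 : ℝ)..S.T, F.f t ⬝ᵥ P t) - ∫ t in S.s..S.T, F.f t ⬝ᵥ a := by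
    rw [← intervalIntegral_dotProduct_indicator_Ioo hsT.1 hsT.2 le_rfl (y := fun _ => a),
      ← intervalIntegral.integral_sub (hF.intervalIntegrable_dotProduct hT hP2)
        (hF.intervalIntegrable_dotProduct hT hκ)]
    refine intervalIntegral_congr_Ioo hT (ae_restrict_of_forall_mem_Ioo fun t ht => ?_)
    have hq := hS.Q₂_posDef t (Ioo_subset_Icc_self ht)
    rw [Matrix.mulVec_add, hq.mulVec_inv_mulVec, Matrix.neg_mulVec, Matrix.mulVec_neg,
      hq.mulVec_inv_mulVec, ← sub_eq_add_neg, sub_dotProduct, dotProduct_comm (P t),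
      dotProduct_comm (F.f t) (_)]
    rw [dotProduct_comm _ (F.f t), dotProduct_comm _ (F.f t)]
  simp only [form]
  rw [hi2, add_zero, hS.Q₀_posDef.mulVec_inv_mulVec, Matrix.mulVec_add, Matrix.mulVec_neg,
    hS.Q₁_posDef.mulVec_inv_mulVec, hS.Q₁_posDef.mulVec_inv_mulVec, add_dotProduct,
    neg_dotProduct, dotProduct_comm _ F.f₀, dotProduct_comm _ F.f₁, dotProduct_comm _ F.f₁,
    dotProduct_comm a]
  rw [hi1] at hL
  linarith

/-- The estimate of `(a, φ(s))` obtained from the coupled system is affine in the observation. -/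
theorem Represents.eval_system (hS : S.Standing) (h₀ : (selBlock e₀ S.B₀).det ≠ 0)
    (h₁ : (selBlock e₁ S.B₁).det ≠ 0) (hD : S.Represents a D ψ) {φ₀ : ℝ → Fin n → ℝ}
    (hφ₀ : S.SolvesBVP S.centre φ₀) {y : ℝ → Fin l → ℝ} (hy : IsL2 S.α S.β y)
    {p φ : Fin 4 → ℝ → Fin n → ℝ} (h : S.SolvesSystem e₀ e₁ y p φ) :
    a ⬝ᵥ φ 1 S.s = (∫ t in S.α..S.β, ((S.Q t * S.H t) *ᵥ ψ t) ⬝ᵥ y t)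
      + (a ⬝ᵥ φ₀ S.s
        - ∫ t in S.α..S.β, ((S.Q t * S.H t) *ᵥ ψ t) ⬝ᵥ (S.H t *ᵥ φ₀ t)) := by
  have hT := hS.T_pos.le
  have hαβ := hS.α_lt_β.le
  have hg := h.solvesGlobal hS
  have hs : φ 1 S.s = S.glue φ S.s :=
    (samePieces_glue hS h.φ_α h.φ_s h.φ_β).2.1 ⟨hS.α_lt_s.le, le_rfl⟩
  rw [hs]
  set Φ := S.glue φ
  set P := S.glue p
  have hΦ : S.SolvesBVP ⟨_, _, _⟩ Φ := ⟨hg.φ_eq, hg.φ_zero, hg.φ_T⟩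
  have hΦc := hΦ.continuousOn hS
  have hψc := hD.solves.continuousOn hS
  -- Two evaluations of one quantity: representing the data of Φ − φ₀ by D, and Lagrange's identity
  -- between ψ and P. By symmetry both contain D paired with P, and eliminating it leaves (a, Φ(s))
  -- as an affine function of y.
  have hr1 := hD.rep _ _ (hΦ.addSmul hS (-1) hφ₀)
  have hL := hD.solves.1.lagrange hT hS.A_cont hg.p_eq
  rw [dotProduct_eq_of_hatMat_eq_zero e₁ h₁ hg.p_T, dotProduct_eq_of_hatMat_eq_zero e₀ h₀ hg.p_zero,
    hD.solves.2.1, hD.solves.2.2] at hL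
  have hu := isL2_QH_mulVec hS hψc
  have hi1 : ∫ t in (0 : ℝ)..S.T, ψ t ⬝ᵥ (S.source y t - S.gram t *ᵥ Φ t)
      = (∫ t in S.α..S.β, ((S.Q t * S.H t) *ᵥ ψ t) ⬝ᵥ y t)
        - ∫ t in S.α..S.β, ((S.Q t * S.H t) *ᵥ ψ t) ⬝ᵥ (S.H t *ᵥ Φ t) := by
    rw [← intervalIntegral.integral_sub (hu.intervalIntegrable_dotProduct hαβ hy)
      (hu.intervalIntegrable_dotProduct hαβ (isL2_H_mulVec hS hΦc)),
      ← intervalIntegral_indicator_Ioo hS.zero_le_α hαβ hS.β_le_T]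
    congr 1
    ext1 t
    by_cases ht : t ∈ Ioo S.α S.β
    · rw [source_sub_gram_of_mem ht, indicator_of_mem ht, ← dotProduct_sub,
        QH_mulVec_dotProduct hS ht]
    · rw [source_sub_gram_of_notMem ht, indicator_of_notMem ht, dotProduct_zero]
  have hi2 : ∫ t in S.α..S.β, ((S.Q t * S.H t) *ᵥ ψ t) ⬝ᵥ (S.H t *ᵥ (Φ t + (-1 : ℝ) • φ₀ t))
      = (∫ t in S.α..S.β, ((S.Q t * S.H t) *ᵥ ψ t) ⬝ᵥ (S.H t *ᵥ Φ t))
        - ∫ t in S.α..S.β, ((S.Q t * S.H t) *ᵥ ψ t) ⬝ᵥ (S.H t *ᵥ φ₀ t) := by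
    rw [← intervalIntegral.integral_sub
      (hu.intervalIntegrable_dotProduct hαβ (isL2_H_mulVec hS hΦc))
      (hu.intervalIntegrable_dotProduct hαβ (isL2_H_mulVec hS (hφ₀.continuousOn hS)))]
    congr 1
    ext1 t
    rw [neg_one_smul, ← sub_eq_add_neg, Matrix.mulVec_sub, dotProduct_sub]
  have hform : S.form D (Rhs.addSmul ⟨S.Q₀⁻¹ *ᵥ (barMat e₀ S.B₀ *ᵥ P 0) + S.centre.f₀,
        -(S.Q₁⁻¹ *ᵥ (barMat e₁ S.B₁ *ᵥ P S.T)) + S.centre.f₁,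
        fun t => (S.Q₂ t)⁻¹ *ᵥ P t + S.centre.f t⟩ (-1) S.centre)
      = D.f₀ ⬝ᵥ (barMat e₀ S.B₀ *ᵥ P 0) - D.f₁ ⬝ᵥ (barMat e₁ S.B₁ *ᵥ P S.T)
        + ∫ t in (0 : ℝ)..S.T, D.f t ⬝ᵥ P t := by
    simp only [form, Rhs.addSmul, neg_one_smul, add_neg_cancel_right]
    rw [hS.Q₀_posDef.mulVec_dotProduct_comm, hS.Q₁_posDef.mulVec_dotProduct_comm,
      hS.Q₀_posDef.mulVec_inv_mulVec, Matrix.mulVec_neg, hS.Q₁_posDef.mulVec_inv_mulVec,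
      neg_dotProduct, dotProduct_comm _ D.f₀, dotProduct_comm _ D.f₁, ← sub_eq_add_neg]
    congr 1
    refine intervalIntegral_congr_Ioo hT (ae_restrict_of_forall_mem_Ioo fun t ht => ?_)
    have hq := hS.Q₂_posDef t (Ioo_subset_Icc_self ht)
    rw [hq.mulVec_dotProduct_comm, hq.mulVec_inv_mulVec, dotProduct_comm]
  rw [hform, hi2, neg_one_smul, ← sub_eq_add_neg, dotProduct_sub] at hr1
  rw [hi1] at hL
  linarith

end Duality

/-! ### The quadratic form of the noise weight -/

/-- The bilinear form `∫ (Q⁻¹ u, v) dt` on the coefficients of linear estimates. -/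
noncomputable def coeffForm (S : Problem n m l) (u v : ℝ → Fin l → ℝ) : ℝ :=
  ∫ t in S.α..S.β, ((S.Q t)⁻¹ *ᵥ u t) ⬝ᵥ v t

theorem coeffForm_self_nonneg (hS : S.Standing) (u : ℝ → Fin l → ℝ) : 0 ≤ S.coeffForm u u :=
  intervalIntegral.integral_nonneg hS.α_lt_β.le fun t ht =>
    (hS.Q_posDef t ht).inv.mulVec_dotProduct_nonneg _

theorem coeffForm_add_self (hS : S.Standing) {u w : ℝ → Fin l → ℝ} (hu : IsL2 S.α S.β u)
    (hw : IsL2 S.α S.β w) :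
    S.coeffForm (fun t => u t + w t) (fun t => u t + w t)
      = S.coeffForm u u + 2 * S.coeffForm w u + S.coeffForm w w := by
  have hαβ := hS.α_lt_β.le
  have i1 := (hu.mulVec hS.Q_inv_cont).intervalIntegrable_dotProduct hαβ hu
  have i2 := (hw.mulVec hS.Q_inv_cont).intervalIntegrable_dotProduct hαβ hu
  have i3 := (hw.mulVec hS.Q_inv_cont).intervalIntegrable_dotProduct hαβ hw
  simp only [coeffForm]
  rw [← intervalIntegral.integral_const_mul, ← intervalIntegral.integral_add i1 (i2.const_mul 2),
    ← intervalIntegral.integral_add (i1.add (i2.const_mul 2)) i3]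
  refine intervalIntegral_congr_Ioo hαβ (ae_restrict_of_forall_mem_Ioo fun t ht => ?_)
  have := (hS.Q_posDef t (Ioo_subset_Icc_self ht)).inv.mulVec_dotProduct_comm (u t) (w t)
  simp only [Matrix.mulVec_add, add_dotProduct, dotProduct_add, this]
  ring

/-- Definiteness is the source of the uniqueness of the optimal coefficient. -/
theorem ae_eq_zero_of_coeffForm_self (hS : S.Standing) {u : ℝ → Fin l → ℝ}
    (hu : IsL2 S.α S.β u) (h : S.coeffForm u u = 0) :
    ∀ᵐ t ∂volume.restrict (Ioo S.α S.β), u t = 0 := by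
  rw [coeffForm, intervalIntegral_eq_Ioo hS.α_lt_β.le, integral_eq_zero_iff_of_nonneg_ae] at h
  · filter_upwards [h, ae_restrict_of_forall_mem_Ioo fun t ht => ht] with t h1 ht
    exact (hS.Q_posDef t (Ioo_subset_Icc_self ht)).inv.eq_zero_of_mulVec_dotProduct h1
  · exact ae_restrict_of_forall_mem_Ioo fun t ht =>
      (hS.Q_posDef t (Ioo_subset_Icc_self ht)).inv.mulVec_dotProduct_nonneg _
  · exact (hu.mulVec hS.Q_inv_cont).integrable_dotProduct hu

theorem sq_integral_dotProduct_le (hS : S.Standing) {u x : ℝ → Fin l → ℝ} (hu : IsL2 S.α S.β u)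
    (hx : IsL2 S.α S.β x) :
    (∫ t in S.α..S.β, u t ⬝ᵥ x t) ^ 2
      ≤ S.coeffForm u u * ∫ t in S.α..S.β, (S.Q t *ᵥ x t) ⬝ᵥ x t := by
  have hαβ := hS.α_lt_β.le
  have i1 := (hu.mulVec hS.Q_inv_cont).intervalIntegrable_dotProduct hαβ hu
  have i2 := hu.intervalIntegrable_dotProduct hαβ hx
  have i3 := (hx.mulVec hS.Q_cont).intervalIntegrable_dotProduct hαβ hx
  -- Weighted Cauchy–Schwarz: the polynomial is ∫(Q(x + rQ⁻¹u), x + rQ⁻¹u), nonnegative for all r.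
  have h := discrim_le_zero (a := S.coeffForm u u) (b := 2 * ∫ t in S.α..S.β, u t ⬝ᵥ x t)
    (c := ∫ t in S.α..S.β, (S.Q t *ᵥ x t) ⬝ᵥ x t) fun r => by
      rw [coeffForm, mul_comm, ← intervalIntegral.integral_const_mul,
        ← intervalIntegral.integral_const_mul, ← intervalIntegral.integral_mul_const,
        ← intervalIntegral.integral_add (i1.const_mul _) ((i2.const_mul 2).mul_const r),
        ← intervalIntegral.integral_add ((i1.const_mul _).add ((i2.const_mul 2).mul_const r)) i3]
      refine intervalIntegral.integral_nonneg hαβ fun t ht => ?_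
      have hQ := hS.Q_posDef t ht
      refine (hQ.mulVec_dotProduct_nonneg (x t + r • ((S.Q t)⁻¹ *ᵥ u t))).trans_eq ?_
      have h1 := hQ.mulVec_dotProduct_comm (x t) ((S.Q t)⁻¹ *ᵥ u t)
      rw [hQ.mulVec_inv_mulVec] at h1
      simp only [Matrix.mulVec_add, Matrix.mulVec_smul, hQ.mulVec_inv_mulVec, add_dotProduct,
        dotProduct_add, smul_dotProduct, dotProduct_smul, smul_eq_mul, h1,
        dotProduct_comm (u t) ((S.Q t)⁻¹ *ᵥ u t)]
      ring
  rw [discrim] at h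
  linarith

/-! ### The noise -/

section Noise

variable {Ω : Type*} {ξ : ℝ → Ω → Fin l → ℝ} {u : ℝ → Fin l → ℝ}

/-- The effect `∫ (u, ξ) dt` of the noise on a linear estimate. -/
noncomputable def noiseTerm (S : Problem n m l) (u : ℝ → Fin l → ℝ) (ξ : ℝ → Ω → Fin l → ℝ)
    (ω : Ω) : ℝ :=
  ∫ t in S.α..S.β, u t ⬝ᵥ ξ t ω

theorem noiseTerm_eq (hS : S.Standing) :
    S.noiseTerm u ξ = fun ω => ∫ t in Ioo S.α S.β, u t ⬝ᵥ ξ t ω := by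
  ext1 ω
  exact intervalIntegral_eq_Ioo hS.α_lt_β.le

theorem noiseTerm_direction (η : Ω → ℝ) (v : ℝ → Fin l → ℝ) (r : ℝ) (ω : Ω) :
    S.noiseTerm v (fun t ω => (r * η ω) • ((S.Q t)⁻¹ *ᵥ v t)) ω
      = r * η ω * S.coeffForm v v := by
  rw [noiseTerm, coeffForm, ← intervalIntegral.integral_const_mul]
  congr 1
  ext1 t
  rw [dotProduct_smul, smul_eq_mul, dotProduct_comm]

variable [MeasurableSpace Ω] {P : Measure Ω}

/-- One-dimensional noise in the direction `Q⁻¹ v`. -/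
theorem isNoise_of_direction (hS : S.Standing) {η : Ω → ℝ} (hη : MemLp η 2 P)
    (hη0 : ∫ ω, η ω ∂P = 0) (hη1 : ∫ ω, η ω ^ 2 ∂P = 1) {v : ℝ → Fin l → ℝ}
    (hv : IsL2 S.α S.β v) {r : ℝ} (hr : r ^ 2 * S.coeffForm v v ≤ 1) :
    S.IsNoise P fun t ω => (r * η ω) • ((S.Q t)⁻¹ *ᵥ v t) := by
  have hw := hv.mulVec hS.Q_inv_cont
  have hsq : ∀ c : ℝ, ∫ ω, (r * η ω) ^ 2 * c ∂P = r ^ 2 * c := fun c => by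
    simp only [mul_pow]
    rw [integral_mul_const, integral_const_mul, hη1, mul_one]
  refine ⟨?_, fun t _ => ?_, fun t _ i => ?_, ?_, ?_⟩
  · exact ((hη.1.const_mul r).comp_snd (μ := volume.restrict (Ioo S.α S.β))).smul
      (AEStronglyMeasurable.comp_fst (ν := P) hw.1)
  · exact memLp_pi_iff.2 fun i => (hη.const_mul r).mul_const _
  · simp only [Pi.smul_apply, smul_eq_mul]
    rw [integral_mul_const, integral_const_mul, hη0]
    simp
  · have : ∀ t, ∫ ω, ((r * η ω) • ((S.Q t)⁻¹ *ᵥ v t)) ⬝ᵥ ((r * η ω) • ((S.Q t)⁻¹ *ᵥ v t)) ∂P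
        = r ^ 2 * (((S.Q t)⁻¹ *ᵥ v t) ⬝ᵥ ((S.Q t)⁻¹ *ᵥ v t)) := fun t => by
      rw [← hsq]
      refine integral_congr_ae (Filter.Eventually.of_forall fun ω => ?_)
      simp only [smul_dotProduct, dotProduct_smul, smul_eq_mul]
      ring
    simp only [this]
    exact (hw.integrable_dotProduct hw).const_mul _
  · refine le_trans (le_of_eq ?_) hr
    rw [coeffForm, ← intervalIntegral.integral_const_mul]
    refine intervalIntegral_congr_Ioo hS.α_lt_β.le (ae_restrict_of_forall_mem_Ioo fun t ht => ?_)
    have hQ := hS.Q_posDef t (Ioo_subset_Icc_self ht)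
    have hc : corr P (fun t ω => (r * η ω) • ((S.Q t)⁻¹ *ᵥ v t)) t t
        = Matrix.of fun i j => r ^ 2 * (((S.Q t)⁻¹ *ᵥ v t) i * ((S.Q t)⁻¹ *ᵥ v t) j) := by
      ext i j
      simp only [corr, Matrix.of_apply, Pi.smul_apply, smul_eq_mul]
      rw [← hsq]
      refine integral_congr_ae (Filter.Eventually.of_forall fun ω => ?_)
      ring
    have h1 : ((S.Q t)⁻¹ *ᵥ v t) ⬝ᵥ v t
        = (S.Q t *ᵥ ((S.Q t)⁻¹ *ᵥ v t)) ⬝ᵥ ((S.Q t)⁻¹ *ᵥ v t) := by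
      rw [hQ.mulVec_inv_mulVec, dotProduct_comm]
    rw [hc, h1]
    generalize (S.Q t)⁻¹ *ᵥ v t = w
    simp only [Matrix.trace, Matrix.diag, Matrix.mul_apply, Matrix.of_apply, dotProduct,
      Matrix.mulVec, Finset.sum_mul, Finset.mul_sum]
    exact Finset.sum_congr rfl fun i _ => Finset.sum_congr rfl fun j _ => by ring

/-- The worst noise for the coefficient `v`. -/
theorem exists_isNoise_integral_sq_eq (hS : S.Standing)
    (hΩ : ∃ η : Ω → ℝ, MemLp η 2 P ∧ ∫ ω, η ω ∂P = 0 ∧ ∫ ω, η ω ^ 2 ∂P = 1)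
    {v : ℝ → Fin l → ℝ} (hv : IsL2 S.α S.β v) :
    ∃ ξ : ℝ → Ω → Fin l → ℝ, S.IsNoise P ξ ∧
      ∫ ω, S.noiseTerm v ξ ω ^ 2 ∂P = S.coeffForm v v := by
  obtain ⟨η, hη, hη0, hη1⟩ := hΩ
  have h0 := coeffForm_self_nonneg hS v
  set N := S.coeffForm v v with hN
  -- The scale 1/√N exhausts the noise budget. For N = 0 the inverse is 0, so the noise vanishes and
  -- both sides are 0.
  have hr : (√N)⁻¹ ^ 2 = N⁻¹ := by rw [inv_pow, Real.sq_sqrt h0]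
  refine ⟨_, isNoise_of_direction hS hη hη0 hη1 hv (r := (√N)⁻¹) ?_, ?_⟩
  · rw [hr, ← hN]
    exact inv_mul_le_one
  · simp only [noiseTerm_direction, ← hN, mul_pow, hr]
    rw [integral_mul_const, integral_const_mul, hη1]
    rcases h0.eq_or_lt with h | h
    · simp [← h]
    · field_simp

variable [IsProbabilityMeasure P]

/-- Tonelli: joint measurability and the integrable second moments give square integrability on the
product, which justifies every later exchange of ∫dt with the expectation. -/
theorem IsNoise.memLp_prod (hξ : S.IsNoise P ξ) (i : Fin l) :
    MemLp (fun z : ℝ × Ω => ξ z.1 z.2 i) 2 ((volume.restrict (Ioo S.α S.β)).prod P) := by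
  have hm : ∀ i, AEStronglyMeasurable (fun z : ℝ × Ω => ξ z.1 z.2 i)
      ((volume.restrict (Ioo S.α S.β)).prod P) := fun i =>
    (continuous_apply i).comp_aestronglyMeasurable hξ.aesm
  have hm2 : AEStronglyMeasurable (fun z : ℝ × Ω => ξ z.1 z.2 ⬝ᵥ ξ z.1 z.2)
      ((volume.restrict (Ioo S.α S.β)).prod P) :=
    Finset.aestronglyMeasurable_fun_sum _ fun i _ => (hm i).mul (hm i)
  have hint : Integrable (fun z : ℝ × Ω => ξ z.1 z.2 ⬝ᵥ ξ z.1 z.2)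
      ((volume.restrict (Ioo S.α S.β)).prod P) := by
    refine (integrable_prod_iff hm2).2 ⟨ae_restrict_of_forall_mem_Ioo fun t ht => ?_, ?_⟩
    · have := memLp_pi_iff.1 (hξ.memLp t ht)
      exact integrable_finsetSum _ fun i _ => (this i).integrable_mul (this i)
    · refine (integrable_congr (Filter.Eventually.of_forall fun t => ?_)).1 hξ.second
      refine integral_congr_ae (Filter.Eventually.of_forall fun ω => ?_)
      exact (Real.norm_of_nonneg (Finset.sum_nonneg fun _ _ => mul_self_nonneg _)).symm
  refine (memLp_two_iff_integrable_sq (hm i)).2 (hint.mono' ((hm i).pow 2)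
    (Filter.Eventually.of_forall fun z => ?_))
  rw [Real.norm_of_nonneg (sq_nonneg _), sq]
  exact Finset.single_le_sum (f := fun i => ξ z.1 z.2 i * ξ z.1 z.2 i)
    (fun _ _ => mul_self_nonneg _) (Finset.mem_univ i)

theorem IsNoise.ae_isL2 (hξ : S.IsNoise P ξ) : ∀ᵐ ω ∂P, IsL2 S.α S.β fun t => ξ t ω := by
  have h : ∀ᵐ ω ∂P, ∀ i, MemLp (fun t => ξ t ω i) 2 (volume.restrict (Ioo S.α S.β)) := by
    refine ae_all_iff.2 fun i => ?_
    filter_upwards [((hξ.memLp_prod i).integrable (by norm_num)).prod_left_ae,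
      (hξ.memLp_prod i).integrable_sq.prod_left_ae] with ω h1 h2
    exact (memLp_two_iff_integrable_sq h1.1).2 h2
  filter_upwards [h] with ω hω using isL2_iff.2 hω

theorem ae_isL2_obs (hS : S.Standing) (hξ : S.IsNoise P ξ) {φ : ℝ → Fin n → ℝ}
    (hφ : ContinuousOn φ (Icc 0 S.T)) : ∀ᵐ ω ∂P, IsL2 S.α S.β (S.obs φ ξ ω) := by
  filter_upwards [hξ.ae_isL2] with ω hω using IsL2.add (isL2_H_mulVec hS hφ) hω

theorem IsNoise.integrable_dotProduct (hξ : S.IsNoise P ξ) (hu : IsL2 S.α S.β u) :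
    Integrable (fun z : ℝ × Ω => u z.1 ⬝ᵥ ξ z.1 z.2) ((volume.restrict (Ioo S.α S.β)).prod P) :=
  integrable_finsetSum _ fun i _ =>
    ((isL2_iff.1 hu i).comp_fst P).integrable_mul (hξ.memLp_prod i)

theorem IsNoise.integrable_weighted (hS : S.Standing) (hξ : S.IsNoise P ξ) :
    Integrable (fun z : ℝ × Ω => (S.Q z.1 *ᵥ ξ z.1 z.2) ⬝ᵥ ξ z.1 z.2)
      ((volume.restrict (Ioo S.α S.β)).prod P) := by
  have h : ∀ i, MemLp (fun z : ℝ × Ω => ∑ j, S.Q z.1 i j * ξ z.1 z.2 j) 2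
      ((volume.restrict (Ioo S.α S.β)).prod P) := fun i =>
    memLp_finsetSum _ fun j _ => MemLp.mul (p := ∞) (q := 2) (hξ.memLp_prod j)
      ((ContinuousOn.memLp_Ioo (continuousOn_entry hS.Q_cont i j) ∞).comp_fst P)
  exact integrable_finsetSum _ fun i _ => (h i).integrable_mul (hξ.memLp_prod i)

theorem IsNoise.integrable_noiseTerm (hS : S.Standing) (hξ : S.IsNoise P ξ)
    (hu : IsL2 S.α S.β u) : Integrable (S.noiseTerm u ξ) P := by
  rw [noiseTerm_eq hS]
  exact (hξ.integrable_dotProduct hu).integral_prod_right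

theorem IsNoise.integral_noiseTerm (hS : S.Standing) (hξ : S.IsNoise P ξ)
    (hu : IsL2 S.α S.β u) : ∫ ω, S.noiseTerm u ξ ω ∂P = 0 := by
  rw [noiseTerm_eq hS, ← integral_integral_swap (hξ.integrable_dotProduct hu)]
  refine integral_eq_zero_of_ae (ae_restrict_of_forall_mem_Ioo fun t ht => ?_)
  have hi := memLp_pi_iff.1 (hξ.memLp t ht)
  simp only [dotProduct, Pi.zero_apply]
  rw [integral_finsetSum _ fun i _ => ((hi i).integrable (by norm_num)).const_mul (u t i)]
  simp [integral_const_mul, hξ.mean t ht]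

/-- After the integrals are exchanged, M(Qξ, ξ) = Sp[Q R(t, t)] and the trace constraint applies. -/
theorem IsNoise.integral_weighted_le (hS : S.Standing) (hξ : S.IsNoise P ξ) :
    ∫ ω, (∫ t in Ioo S.α S.β, (S.Q t *ᵥ ξ t ω) ⬝ᵥ ξ t ω) ∂P ≤ 1 := by
  rw [← integral_integral_swap (hξ.integrable_weighted hS)]
  refine le_trans (le_of_eq ?_) hξ.trace_le
  rw [intervalIntegral_eq_Ioo hS.α_lt_β.le]
  refine integral_congr_ae (ae_restrict_of_forall_mem_Ioo fun t ht => ?_)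
  have hi := memLp_pi_iff.1 (hξ.memLp t ht)
  have hij : ∀ i j, Integrable (fun ω => S.Q t i j * ξ t ω j * ξ t ω i) P := fun i j => by
    simpa only [mul_assoc, Pi.mul_def] using ((hi j).integrable_mul (hi i)).const_mul (S.Q t i j)
  simp only [dotProduct, Matrix.mulVec, Matrix.trace, Matrix.diag, Matrix.mul_apply, corr,
    Matrix.of_apply, Finset.sum_mul]
  rw [integral_finsetSum _ fun i _ => integrable_finsetSum _ fun j _ => hij i j]
  refine Finset.sum_congr rfl fun i _ => ?_
  rw [integral_finsetSum _ fun j _ => hij i j]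
  refine Finset.sum_congr rfl fun j _ => ?_
  simp only [mul_assoc]
  rw [integral_const_mul]

/-- Cauchy–Schwarz for almost every realization, followed by the expectation of the weighted energy,
which is at most 1. -/
theorem IsNoise.memLp_noiseTerm (hS : S.Standing) (hξ : S.IsNoise P ξ) (hu : IsL2 S.α S.β u) :
    MemLp (S.noiseTerm u ξ) 2 P ∧ ∫ ω, S.noiseTerm u ξ ω ^ 2 ∂P ≤ S.coeffForm u u := by
  have hN : Integrable (fun ω => S.coeffForm u u
      * ∫ t in Ioo S.α S.β, (S.Q t *ᵥ ξ t ω) ⬝ᵥ ξ t ω) P :=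
    (hξ.integrable_weighted hS).integral_prod_right.const_mul _
  have hle : ∀ᵐ ω ∂P, S.noiseTerm u ξ ω ^ 2 ≤ S.coeffForm u u
      * ∫ t in Ioo S.α S.β, (S.Q t *ᵥ ξ t ω) ⬝ᵥ ξ t ω := by
    filter_upwards [hξ.ae_isL2] with ω hω
    rw [← intervalIntegral_eq_Ioo hS.α_lt_β.le]
    exact sq_integral_dotProduct_le hS hu hω
  have hm := (hξ.integrable_noiseTerm hS hu).1
  have h2 : Integrable (fun ω => S.noiseTerm u ξ ω ^ 2) P := by
    refine hN.mono' (hm.pow 2) ?_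
    filter_upwards [hle] with ω hω
    rwa [Real.norm_of_nonneg (sq_nonneg _)]
  refine ⟨(memLp_two_iff_integrable_sq hm).2 h2, ?_⟩
  calc ∫ ω, S.noiseTerm u ξ ω ^ 2 ∂P
      ≤ ∫ ω, S.coeffForm u u * (∫ t in Ioo S.α S.β, (S.Q t *ᵥ ξ t ω) ⬝ᵥ ξ t ω) ∂P :=
        integral_mono_ae h2 hN hle
    _ = S.coeffForm u u * ∫ ω, (∫ t in Ioo S.α S.β, (S.Q t *ᵥ ξ t ω) ⬝ᵥ ξ t ω) ∂P :=
        integral_const_mul _ _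
    _ ≤ S.coeffForm u u :=
        mul_le_of_le_one_right (coeffForm_self_nonneg hS u) (hξ.integral_weighted_le hS)

/-- The noise term is centred, so the cross term disappears. -/
theorem IsNoise.lintegral_sq_sub (hS : S.Standing) (hξ : S.IsNoise P ξ) (hu : IsL2 S.α S.β u)
    (b : ℝ) : ∫⁻ ω, ENNReal.ofReal ((b - S.noiseTerm u ξ ω) ^ 2) ∂P
      = ENNReal.ofReal (b ^ 2 + ∫ ω, S.noiseTerm u ξ ω ^ 2 ∂P) := by
  have hX := (hξ.memLp_noiseTerm hS hu).1
  have hX1 := hξ.integrable_noiseTerm hS hu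
  have hint : Integrable (fun ω => (b - S.noiseTerm u ξ ω) ^ 2) P :=
    ((memLp_const b).sub hX).integrable_sq
  rw [← ofReal_integral_eq_lintegral_ofReal hint (Filter.Eventually.of_forall fun _ => sq_nonneg _)]
  congr 1
  have : ∀ ω, (b - S.noiseTerm u ξ ω) ^ 2
      = (b ^ 2 + S.noiseTerm u ξ ω ^ 2) - 2 * b * S.noiseTerm u ξ ω := fun ω => by ring
  simp only [this]
  have hint2 : Integrable (fun ω => b ^ 2 + S.noiseTerm u ξ ω ^ 2) P :=
    (integrable_const _).add hX.integrable_sq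
  rw [integral_sub hint2 (hX1.const_mul _),
    integral_add (integrable_const _) hX.integrable_sq, integral_const_mul,
    hξ.integral_noiseTerm hS hu]
  simp

end Noise

/-! ### The ellipsoid of right-hand sides -/

theorem form_self_nonneg (hS : S.Standing) (F : Rhs n m) : 0 ≤ S.form F F :=
  add_nonneg (add_nonneg (hS.Q₀_posDef.mulVec_dotProduct_nonneg _)
    (hS.Q₁_posDef.mulVec_dotProduct_nonneg _))
    (intervalIntegral.integral_nonneg hS.T_pos.le fun t ht =>
      (hS.Q₂_posDef t ht).mulVec_dotProduct_nonneg _)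

theorem form_addSmul_self (hS : S.Standing) {F D : Rhs n m} (hF : IsL2 0 S.T F.f)
    (hD : IsL2 0 S.T D.f) (r : ℝ) : S.form (F.addSmul r D) (F.addSmul r D)
      = S.form D D * (r * r) + 2 * S.form D F * r + S.form F F := by
  have hT := hS.T_pos.le
  have i1 := (hD.mulVec hS.Q₂_cont).intervalIntegrable_dotProduct hT hD
  have i2 := (hD.mulVec hS.Q₂_cont).intervalIntegrable_dotProduct hT hF
  have i3 := (hF.mulVec hS.Q₂_cont).intervalIntegrable_dotProduct hT hF
  have h : ∫ t in (0 : ℝ)..S.T, (S.Q₂ t *ᵥ (F.f t + r • D.f t)) ⬝ᵥ (F.f t + r • D.f t)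
      = (r * r) * (∫ t in (0 : ℝ)..S.T, (S.Q₂ t *ᵥ D.f t) ⬝ᵥ D.f t)
        + (2 * r) * (∫ t in (0 : ℝ)..S.T, (S.Q₂ t *ᵥ D.f t) ⬝ᵥ F.f t)
        + ∫ t in (0 : ℝ)..S.T, (S.Q₂ t *ᵥ F.f t) ⬝ᵥ F.f t := by
    rw [← intervalIntegral.integral_const_mul, ← intervalIntegral.integral_const_mul,
      ← intervalIntegral.integral_add (i1.const_mul _) (i2.const_mul _),
      ← intervalIntegral.integral_add ((i1.const_mul _).add (i2.const_mul _)) i3]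
    refine intervalIntegral_congr_Ioo hT (ae_restrict_of_forall_mem_Ioo fun t ht => ?_)
    have := (hS.Q₂_posDef t (Ioo_subset_Icc_self ht)).mulVec_dotProduct_comm (F.f t) (D.f t)
    simp only [Matrix.mulVec_add, Matrix.mulVec_smul, add_dotProduct, dotProduct_add,
      smul_dotProduct, dotProduct_smul, smul_eq_mul, this]
    ring
  simp only [form, Rhs.addSmul]
  rw [h]
  have h0 := hS.Q₀_posDef.mulVec_dotProduct_comm F.f₀ D.f₀
  have h1 := hS.Q₁_posDef.mulVec_dotProduct_comm F.f₁ D.f₁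
  simp only [Matrix.mulVec_add, Matrix.mulVec_smul, add_dotProduct, dotProduct_add,
    smul_dotProduct, dotProduct_smul, smul_eq_mul, h0, h1]
  ring

/-- Cauchy–Schwarz for the ellipsoid's form, from the discriminant of r ↦ form(F + rD, F + rD). -/
theorem sq_form_le (hS : S.Standing) {F D : Rhs n m} (hF : IsL2 0 S.T F.f)
    (hD : IsL2 0 S.T D.f) : S.form D F ^ 2 ≤ S.form D D * S.form F F := by
  have h := discrim_le_zero fun r =>
    (form_self_nonneg hS (F.addSmul r D)).trans_eq (form_addSmul_self hS hF hD r)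
  rw [discrim] at h
  linarith

theorem form_sub_centre_le {F : Rhs n m} (hF : F ∈ S.G) :
    S.form (F.addSmul (-1) S.centre) (F.addSmul (-1) S.centre) ≤ 1 := by
  simpa only [form, Rhs.addSmul, neg_one_smul, ← sub_eq_add_neg] using hF.2

theorem centre_addSmul_mem_G (hS : S.Standing) {D : Rhs n m} (hD : IsL2 0 S.T D.f) {r : ℝ}
    (hr : r ^ 2 * S.form D D ≤ 1) : S.centre.addSmul r D ∈ S.G := by
  refine ⟨hS.centre_L2.add_smul r hD, le_trans (le_of_eq ?_) hr⟩
  simp only [form, Rhs.addSmul, add_sub_cancel_left, Matrix.mulVec_smul, smul_dotProduct,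
    dotProduct_smul, smul_eq_mul, intervalIntegral.integral_const_mul]
  ring

/-! ### Linear estimates and their worst-case errors -/

/-- The mean error of the estimate `∫ (u, y) dt` of `(a, φ(s))`. -/
noncomputable def bias (S : Problem n m l) (a : Fin n → ℝ) (u : ℝ → Fin l → ℝ)
    (φ : ℝ → Fin n → ℝ) : ℝ :=
  a ⬝ᵥ φ S.s - ∫ t in S.α..S.β, u t ⬝ᵥ (S.H t *ᵥ φ t)

theorem bias_add_smul (hS : S.Standing) (a : Fin n → ℝ) {u : ℝ → Fin l → ℝ}
    (hu : IsL2 S.α S.β u) {φ φ' : ℝ → Fin n → ℝ} (hφ : ContinuousOn φ (Icc 0 S.T))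
    (hφ' : ContinuousOn φ' (Icc 0 S.T)) (r : ℝ) :
    S.bias a u (fun t => φ t + r • φ' t) = S.bias a u φ + r * S.bias a u φ' := by
  have i1 := hu.intervalIntegrable_dotProduct hS.α_lt_β.le (isL2_H_mulVec hS hφ)
  have i2 := hu.intervalIntegrable_dotProduct hS.α_lt_β.le (isL2_H_mulVec hS hφ')
  simp only [bias, Matrix.mulVec_add, Matrix.mulVec_smul, dotProduct_add, dotProduct_smul,
    smul_eq_mul]
  rw [intervalIntegral.integral_add i1 (i2.const_mul r), intervalIntegral.integral_const_mul]
  ring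

theorem bias_sub_bias (hS : S.Standing) (a : Fin n → ℝ) {u v : ℝ → Fin l → ℝ}
    (hu : IsL2 S.α S.β u) (hv : IsL2 S.α S.β v) {φ : ℝ → Fin n → ℝ}
    (hφ : ContinuousOn φ (Icc 0 S.T)) :
    S.bias a u φ - S.bias a v φ = ∫ t in S.α..S.β, (v t - u t) ⬝ᵥ (S.H t *ᵥ φ t) := by
  have i1 := hu.intervalIntegrable_dotProduct hS.α_lt_β.le (isL2_H_mulVec hS hφ)
  have i2 := hv.intervalIntegrable_dotProduct hS.α_lt_β.le (isL2_H_mulVec hS hφ)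
  simp only [bias, sub_dotProduct]
  rw [intervalIntegral.integral_sub i2 i1]
  ring

/-- The coefficient on `(α, β)` composed of `u₁` on `(α, s)` and `u₂` on `(s, β)`. -/
noncomputable def join (S : Problem n m l) (u₁ u₂ : ℝ → Fin l → ℝ) (t : ℝ) : Fin l → ℝ :=
  (Ioo S.α S.s).indicator u₁ t + (Ioo S.s S.β).indicator u₂ t

theorem isL2_join {u₁ u₂ : ℝ → Fin l → ℝ} (h₁ : IsL2 S.α S.s u₁) (h₂ : IsL2 S.s S.β u₂) :
    IsL2 S.α S.β (S.join u₁ u₂) :=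
  (isL2_indicator h₁).add (isL2_indicator h₂)

/-- The split at s is immaterial: a pair of coefficients is one coefficient on (α, β), up to a null
set. -/
theorem linEst_eq_join (hS : S.Standing) {u₁ u₂ : ℝ → Fin l → ℝ} (h₁ : IsL2 S.α S.s u₁)
    (h₂ : IsL2 S.s S.β u₂) (c : ℝ) {y : ℝ → Fin l → ℝ} (hy : IsL2 S.α S.β y) :
    S.linEst u₁ u₂ c y = (∫ t in S.α..S.β, S.join u₁ u₂ t ⬝ᵥ y t) + c := by
  have e1 := hS.α_lt_s.le
  have e2 := hS.s_lt_β.le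
  have i1 := hy.intervalIntegrable_dotProduct (e1.trans e2) (isL2_indicator h₁)
  have i2 := hy.intervalIntegrable_dotProduct (e1.trans e2) (isL2_indicator h₂)
  simp only [join, dotProduct_comm _ (y _), dotProduct_add]
  rw [intervalIntegral.integral_add i1 i2,
    intervalIntegral_dotProduct_indicator_Ioo le_rfl e1 e2,
    intervalIntegral_dotProduct_indicator_Ioo e1 e2 le_rfl]
  simp only [linEst, dotProduct_comm (y _)]

theorem linEst_self (hS : S.Standing) {u : ℝ → Fin l → ℝ} (hu : IsL2 S.α S.β u) (c : ℝ)
    {y : ℝ → Fin l → ℝ} (hy : IsL2 S.α S.β y) :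
    S.linEst u u c y = (∫ t in S.α..S.β, u t ⬝ᵥ y t) + c := by
  have e1 := hS.α_lt_s.le
  have e2 := hS.s_lt_β.le
  rw [linEst, intervalIntegral.integral_add_adjacent_intervals]
  · exact (hu.mono le_rfl e2).intervalIntegrable_dotProduct e1 (hy.mono le_rfl e2)
  · exact (hu.mono e1 le_rfl).intervalIntegrable_dotProduct e2 (hy.mono e1 le_rfl)

section Risk

variable {Ω : Type*} [MeasurableSpace Ω] {P : Measure Ω}
  {a : Fin n → ℝ} {u : ℝ → Fin l → ℝ} {c : ℝ} {est est' : (ℝ → Fin l → ℝ) → ℝ}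

theorem le_worstRisk {F : Rhs n m} (hF : F ∈ S.G) {φ : ℝ → Fin n → ℝ} (hφ : S.SolvesBVP F φ)
    {ξ : ℝ → Ω → Fin l → ℝ} (hξ : S.IsNoise P ξ) :
    ∫⁻ ω, ENNReal.ofReal ((a ⬝ᵥ φ S.s - est (S.obs φ ξ ω)) ^ 2) ∂P ≤ S.worstRisk P a est :=
  le_iSup_of_le F <| le_iSup_of_le hF <| le_iSup_of_le φ <| le_iSup_of_le hφ <|
    le_iSup_of_le ξ <| le_iSup_of_le hξ le_rfl

variable [IsProbabilityMeasure P]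

/-- Bias–variance decomposition. The estimate has to be affine only on L² observations, since almost
every realization is one; this admits estimates defined through the system. -/
theorem lintegral_sq_error (hS : S.Standing) (hu : IsL2 S.α S.β u)
    (hest : ∀ y, IsL2 S.α S.β y → est y = (∫ t in S.α..S.β, u t ⬝ᵥ y t) + c)
    {φ : ℝ → Fin n → ℝ} (hφ : ContinuousOn φ (Icc 0 S.T)) {ξ : ℝ → Ω → Fin l → ℝ}
    (hξ : S.IsNoise P ξ) :
    ∫⁻ ω, ENNReal.ofReal ((a ⬝ᵥ φ S.s - est (S.obs φ ξ ω)) ^ 2) ∂P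
      = ENNReal.ofReal ((S.bias a u φ - c) ^ 2 + ∫ ω, S.noiseTerm u ξ ω ^ 2 ∂P) := by
  rw [← hξ.lintegral_sq_sub hS hu]
  refine lintegral_congr_ae ?_
  filter_upwards [hξ.ae_isL2] with ω hω
  have hH := isL2_H_mulVec hS hφ
  rw [hest (S.obs φ ξ ω) (hH.add hω)]
  congr 2
  simp only [obs, dotProduct_add, bias, noiseTerm]
  rw [intervalIntegral.integral_add (hu.intervalIntegrable_dotProduct hS.α_lt_β.le hH)
    (hu.intervalIntegrable_dotProduct hS.α_lt_β.le hω)]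
  ring

theorem worstRisk_congr (hS : S.Standing)
    (h : ∀ y, IsL2 S.α S.β y → est y = est' y) :
    S.worstRisk P a est = S.worstRisk P a est' := by
  simp only [worstRisk]
  refine iSup_congr fun F => iSup_congr fun _ => iSup_congr fun φ => iSup_congr fun hφ =>
    iSup_congr fun ξ => iSup_congr fun hξ => lintegral_congr_ae ?_
  filter_upwards [ae_isL2_obs hS hξ (hφ.continuousOn hS)] with ω hω
  rw [h _ hω]

/-! ### The minimax value and the uniqueness of the minimizer. -/

variable {D : Rhs n m} {ψ φ₀ : ℝ → Fin n → ℝ}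

theorem Represents.bias_eq (hD : S.Represents a D ψ) {F : Rhs n m} {φ : ℝ → Fin n → ℝ}
    (hφ : S.SolvesBVP F φ) : S.bias a (fun t => (S.Q t * S.H t) *ᵥ ψ t) φ = S.form D F :=
  hD.rep F φ hφ

/-- With this constant the net bias is form(D, F − centre), at most √form(D, D) in absolute value on
the ellipsoid; the variance is bounded separately. -/
theorem Represents.worstRisk_le (hS : S.Standing) (hD : S.Represents a D ψ)
    (hφ₀ : S.SolvesBVP S.centre φ₀) {û : ℝ → Fin l → ℝ}
    (hû : û = fun t => (S.Q t * S.H t) *ᵥ ψ t)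
    (hest : ∀ y, IsL2 S.α S.β y →
      est y = (∫ t in S.α..S.β, û t ⬝ᵥ y t) + S.bias a û φ₀) :
    S.worstRisk P a est ≤ ENNReal.ofReal (S.form D D + S.coeffForm û û) := by
  have hψc := hD.solves.continuousOn hS
  have hu : IsL2 S.α S.β û := hû ▸ isL2_QH_mulVec hS hψc
  refine iSup_le fun F => iSup_le fun hF => iSup_le fun φ => iSup_le fun hφ => iSup_le fun ξ =>
    iSup_le fun hξ => ?_
  have hφc := hφ.continuousOn hS
  rw [lintegral_sq_error hS hu hest hφc hξ]
  refine ENNReal.ofReal_le_ofReal (add_le_add ?_ (hξ.memLp_noiseTerm hS hu).2)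
  have hd := hφ.addSmul hS (-1) hφ₀
  have h1 : S.bias a û φ - S.bias a û φ₀ = S.form D (F.addSmul (-1) S.centre) := by
    rw [← hD.bias_eq hd, ← hû, bias_add_smul hS a hu hφc (hφ₀.continuousOn hS)]
    ring
  rw [h1]
  refine (sq_form_le hS (hd.isL2 hS) (hD.solves.isL2 hS)).trans ?_
  exact mul_le_of_le_one_right (form_self_nonneg hS D) (form_sub_centre_le hF)

theorem le_worstRisk_of_direction (hS : S.Standing)
    (hΩ : ∃ η : Ω → ℝ, MemLp η 2 P ∧ ∫ ω, η ω ∂P = 0 ∧ ∫ ω, η ω ^ 2 ∂P = 1)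
    (hψ : S.SolvesBVP D ψ) (hφ₀ : S.SolvesBVP S.centre φ₀) (hu : IsL2 S.α S.β u)
    (hest : ∀ y, IsL2 S.α S.β y → est y = (∫ t in S.α..S.β, u t ⬝ᵥ y t) + c) {r : ℝ}
    (hr : r ^ 2 * S.form D D ≤ 1) :
    ENNReal.ofReal ((S.bias a u φ₀ - c) ^ 2 + r ^ 2 * S.bias a u ψ ^ 2 + S.coeffForm u u)
      ≤ S.worstRisk P a est := by
  obtain ⟨ξ, hξ, hξ2⟩ := exists_isNoise_integral_sq_eq (P := P) hS hΩ hu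
  have key : ∀ r : ℝ, r ^ 2 * S.form D D ≤ 1 →
      ENNReal.ofReal ((S.bias a u φ₀ + r * S.bias a u ψ - c) ^ 2 + S.coeffForm u u)
        ≤ S.worstRisk P a est := by
    intro r hr
    have hF := hφ₀.addSmul hS r hψ
    have h := le_worstRisk (a := a) (est := est) (centre_addSmul_mem_G hS (hψ.isL2 hS) hr) hF hξ
    rwa [lintegral_sq_error hS hu hest (hF.continuousOn hS) hξ, hξ2,
      bias_add_smul hS a hu (hφ₀.continuousOn hS) (hψ.continuousOn hS)] at h
  -- Both signs of r are admissible; the one that makes the cross term nonnegative is used.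
  rcases le_total 0 ((S.bias a u φ₀ - c) * (r * S.bias a u ψ)) with h | h
  · refine le_trans (ENNReal.ofReal_le_ofReal ?_) (key r hr)
    nlinarith
  · refine le_trans (ENNReal.ofReal_le_ofReal ?_) (key (-r) (by rwa [neg_sq]))
    nlinarith

/-- With N = form(D, D) and x = ∫(Q⁻¹(u − û), û), the bias of u at ψ is N − x. For N > 0 the test
with r² = 1/N contributes N − 2x + x²/N, and −2x cancels the cross term 2x in the variance of u = û
+ (u − û). -/
theorem Represents.le_worstRisk (hS : S.Standing)
    (hΩ : ∃ η : Ω → ℝ, MemLp η 2 P ∧ ∫ ω, η ω ∂P = 0 ∧ ∫ ω, η ω ^ 2 ∂P = 1)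
    (hD : S.Represents a D ψ) (hφ₀ : S.SolvesBVP S.centre φ₀) {û : ℝ → Fin l → ℝ}
    (hû : û = fun t => (S.Q t * S.H t) *ᵥ ψ t) (hu : IsL2 S.α S.β u)
    (hest : ∀ y, IsL2 S.α S.β y → est y = (∫ t in S.α..S.β, u t ⬝ᵥ y t) + c) :
    ENNReal.ofReal (S.form D D + S.coeffForm û û
        + S.coeffForm (fun t => u t - û t) (fun t => u t - û t) + (S.bias a u φ₀ - c) ^ 2)
      ≤ S.worstRisk P a est := by
  have hψc := hD.solves.continuousOn hS
  have hû2 : IsL2 S.α S.β û := hû ▸ isL2_QH_mulVec hS hψc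
  have hexp : S.coeffForm u u = S.coeffForm û û + 2 * S.coeffForm (fun t => u t - û t) û
      + S.coeffForm (fun t => u t - û t) (fun t => u t - û t) := by
    rw [← coeffForm_add_self hS hû2 (hu.sub hû2)]
    simp only [add_sub_cancel]
  have hbias : S.bias a u ψ = S.form D D - S.coeffForm (fun t => u t - û t) û := by
    have h1 := bias_sub_bias hS a hû2 hu hψc
    rw [hû, hD.bias_eq hD.solves, ← hû] at h1
    have h2 : ∫ t in S.α..S.β, (u t - û t) ⬝ᵥ (S.H t *ᵥ ψ t)
        = S.coeffForm (fun t => u t - û t) û := by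
      refine intervalIntegral_congr_Ioo hS.α_lt_β.le (ae_restrict_of_forall_mem_Ioo fun t ht => ?_)
      have hQ := hS.Q_posDef t (Ioo_subset_Icc_self ht)
      rw [hQ.inv.mulVec_dotProduct_comm, dotProduct_comm (u t - û t)]
      congr 1
      rw [hû]
      beta_reduce
      rw [← Matrix.mulVec_mulVec, hQ.inv_mulVec_mulVec]
    linarith
  have h0 := form_self_nonneg hS D
  generalize hN : S.form D D = N at *
  generalize hx : S.coeffForm (fun t => u t - û t) û = x at *
  rcases h0.eq_or_lt with h | h
  · have hr2 : √(2 / |x|) ^ 2 = 2 / |x| := Real.sq_sqrt (by positivity)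
    refine le_trans (ENNReal.ofReal_le_ofReal ?_)
      (le_worstRisk_of_direction hS hΩ hD.solves hφ₀ hu hest (r := √(2 / |x|))
        (by rw [hN, ← h, mul_zero]; exact zero_le_one))
    have hx2 : 2 / |x| * x ^ 2 = 2 * |x| := by
      rcases eq_or_ne x 0 with h' | h'
      · simp [h']
      · rw [← sq_abs]
        field_simp
    rw [hexp, hbias, hr2, ← h, zero_sub, neg_sq, hx2]
    linarith [neg_abs_le x]
  · have hr2 : (√N)⁻¹ ^ 2 = N⁻¹ := by rw [inv_pow, Real.sq_sqrt h0]
    refine le_trans (ENNReal.ofReal_le_ofReal ?_)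
      (le_worstRisk_of_direction hS hΩ hD.solves hφ₀ hu hest (r := (√N)⁻¹)
        (by rw [hN, hr2, inv_mul_cancel₀ h.ne']))
    have hx2 : N⁻¹ * (N - x) ^ 2 = N - 2 * x + N⁻¹ * x ^ 2 := by
      field_simp
      ring
    rw [hexp, hbias, hr2, hx2]
    have : 0 ≤ N⁻¹ * x ^ 2 := by positivity
    linarith

variable {û : ℝ → Fin l → ℝ}

theorem Represents.isMinimax (hS : S.Standing)
    (hΩ : ∃ η : Ω → ℝ, MemLp η 2 P ∧ ∫ ω, η ω ∂P = 0 ∧ ∫ ω, η ω ^ 2 ∂P = 1)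
    (hD : S.Represents a D ψ) (hφ₀ : S.SolvesBVP S.centre φ₀)
    (hû : û = fun t => (S.Q t * S.H t) *ᵥ ψ t) : S.IsMinimax P a û û (S.bias a û φ₀) := by
  have hû2 : IsL2 S.α S.β û := hû ▸ isL2_QH_mulVec hS (hD.solves.continuousOn hS)
  refine ⟨hû2.mono le_rfl hS.s_lt_β.le, hû2.mono hS.α_lt_s.le le_rfl, fun v₁ v₂ d h₁ h₂ => ?_⟩
  refine (hD.worstRisk_le hS hφ₀ hû fun y hy => linEst_self hS hû2 _ hy).trans
    (le_trans (ENNReal.ofReal_le_ofReal ?_) (hD.le_worstRisk hS hΩ hφ₀ hû (isL2_join h₁ h₂)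
      fun y hy => linEst_eq_join hS h₁ h₂ d hy))
  rw [add_assoc]
  exact le_add_of_nonneg_right (add_nonneg (coeffForm_self_nonneg hS _) (sq_nonneg _))

/-- A minimizer cannot exceed the risk of û, so the two nonnegative excess terms of the lower bound
vanish: the coefficient is û almost everywhere and the constant is the bias at the centre. -/
theorem Represents.linEst_of_isMinimax (hS : S.Standing)
    (hΩ : ∃ η : Ω → ℝ, MemLp η 2 P ∧ ∫ ω, η ω ∂P = 0 ∧ ∫ ω, η ω ^ 2 ∂P = 1)
    (hD : S.Represents a D ψ) (hφ₀ : S.SolvesBVP S.centre φ₀)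
    (hû : û = fun t => (S.Q t * S.H t) *ᵥ ψ t) {u₁ u₂ : ℝ → Fin l → ℝ}
    (h : S.IsMinimax P a u₁ u₂ c) {y : ℝ → Fin l → ℝ} (hy : IsL2 S.α S.β y) :
    S.linEst u₁ u₂ c y = (∫ t in S.α..S.β, û t ⬝ᵥ y t) + S.bias a û φ₀ := by
  have hψc := hD.solves.continuousOn hS
  have hû2 : IsL2 S.α S.β û := hû ▸ isL2_QH_mulVec hS hψc
  obtain ⟨h₁, h₂, hmin⟩ := h
  have hu := isL2_join h₁ h₂
  have hle := ((hD.le_worstRisk hS hΩ hφ₀ hû hu fun y hy =>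
    linEst_eq_join hS h₁ h₂ c hy).trans (hmin û û (S.bias a û φ₀)
      (hû2.mono le_rfl hS.s_lt_β.le) (hû2.mono hS.α_lt_s.le le_rfl))).trans
    (hD.worstRisk_le hS hφ₀ hû fun y hy => linEst_self hS hû2 _ hy)
  rw [ENNReal.ofReal_le_ofReal_iff
    (add_nonneg (form_self_nonneg hS D) (coeffForm_self_nonneg hS û))] at hle
  have hw0 := coeffForm_self_nonneg hS fun t => S.join u₁ u₂ t - û t
  have hb0 := sq_nonneg (S.bias a (S.join u₁ u₂) φ₀ - c)
  have hw := ae_eq_zero_of_coeffForm_self hS (hu.sub hû2) (by linarith)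
  have hc : S.bias a (S.join u₁ u₂) φ₀ - c = 0 := pow_eq_zero_iff two_ne_zero |>.1 (by linarith)
  have hint : ∀ z : ℝ → Fin l → ℝ, ∫ t in S.α..S.β, S.join u₁ u₂ t ⬝ᵥ z t
      = ∫ t in S.α..S.β, û t ⬝ᵥ z t := fun z => by
    refine intervalIntegral_congr_Ioo hS.α_lt_β.le ?_
    filter_upwards [hw] with t ht
    rw [sub_eq_zero.1 ht]
  rw [linEst_eq_join hS h₁ h₂ c hy, hint, ← sub_eq_zero.1 hc, bias, bias, hint]

end Risk

end Problem

end BVPEstimation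

/-! ### Assembly of the theorem. -/

theorem theorem3p2 {n m l : ℕ} (S : BVPEstimation.Problem n m l) (hS : S.Standing)
    -- a choice of nondegenerate square blocks of `B₀` and `B₁`
    (e₀ : Fin m ⊕ Fin (n - m) ≃ Fin n) (e₁ : Fin (n - m) ⊕ Fin m ≃ Fin n)
    (h₀ : (BVPEstimation.selBlock e₀ S.B₀).det ≠ 0)
    (h₁ : (BVPEstimation.selBlock e₁ S.B₁).det ≠ 0)
    -- a probability space that carries a random variable with mean 0 and variance 1
    {Ω : Type*} [MeasurableSpace Ω] (P : Measure Ω) [IsProbabilityMeasure P]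
    (hΩ : ∃ η : Ω → ℝ, MemLp η 2 P ∧ ∫ ω, η ω ∂P = 0 ∧ ∫ ω, η ω ^ 2 ∂P = 1) :
    -- the system is uniquely solvable for every square integrable realization `y`
    (∀ y : ℝ → Fin l → ℝ, BVPEstimation.IsL2 S.α S.β y →
      (∃ p φ, S.SolvesSystem e₀ e₁ y p φ) ∧
      ∀ p φ p' φ', S.SolvesSystem e₀ e₁ y p φ → S.SolvesSystem e₀ e₁ y p' φ' →
        S.SamePieces p p' ∧ S.SamePieces φ φ') ∧
    -- almost all realizations of the observations are square integrable
    (∀ F ∈ S.G, ∀ φ, S.SolvesBVP F φ → ∀ ξ : ℝ → Ω → Fin l → ℝ, S.IsNoise P ξ →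
      ∀ᵐ ω ∂P, BVPEstimation.IsL2 S.α S.β (S.obs φ ξ ω)) ∧
    -- the minimax estimate of `(a, φ(s))` exists and equals `(a, φ̂₂(s))`
    (∀ a : Fin n → ℝ,
      (∃ u₁ u₂ c, S.IsMinimax P a u₁ u₂ c) ∧
      ∀ u₁ u₂ c, S.IsMinimax P a u₁ u₂ c →
        ∀ y, BVPEstimation.IsL2 S.α S.β y → ∀ p φ, S.SolvesSystem e₀ e₁ y p φ →
          S.linEst u₁ u₂ c y = a ⬝ᵥ φ 1 S.s) ∧
    -- the map `Φ : y ↦ φ̂₂(s)`, which does not depend on `a`, estimates `φ(s)`: for all `a` at once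
    -- `(a, Φ(y))` attains the least worst-case error among the linear estimates of `(a, φ(s))`
    (∃ Φ : (ℝ → Fin l → ℝ) → Fin n → ℝ,
      (∀ y, BVPEstimation.IsL2 S.α S.β y → ∀ p φ, S.SolvesSystem e₀ e₁ y p φ →
        φ 1 S.s = Φ y) ∧
      ∀ a : Fin n → ℝ,
        S.worstRisk P a (fun y => a ⬝ᵥ Φ y) =
          ⨅ (u₁ : ℝ → Fin l → ℝ) (_ : BVPEstimation.IsL2 S.α S.s u₁)
            (u₂ : ℝ → Fin l → ℝ) (_ : BVPEstimation.IsL2 S.s S.β u₂) (c : ℝ),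
            S.worstRisk P a (S.linEst u₁ u₂ c)) := by
  choose D ψ hD using BVPEstimation.Problem.exists_represents hS h₀ h₁
  obtain ⟨φ₀, hφ₀⟩ := BVPEstimation.Problem.exists_solvesBVP hS S.centre hS.centre_L2
  have hû2 := fun a => BVPEstimation.Problem.isL2_QH_mulVec hS ((hD a).solves.continuousOn hS)
  have hmin := fun a => (hD a).isMinimax (P := P) hS hΩ hφ₀ rfl
  -- Bridge between the two descriptions of the estimate: through the system driven by y, and
  -- through the coefficient QHψ.
  have hval : ∀ (a : Fin n → ℝ) y, BVPEstimation.IsL2 S.α S.β y → ∀ p φ,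
      S.SolvesSystem e₀ e₁ y p φ → a ⬝ᵥ φ 1 S.s = S.linEst (fun t => (S.Q t * S.H t) *ᵥ ψ a t)
        (fun t => (S.Q t * S.H t) *ᵥ ψ a t)
        (S.bias a (fun t => (S.Q t * S.H t) *ᵥ ψ a t) φ₀) y := fun a y hy p φ h => by
    rw [(hD a).eval_system hS h₀ h₁ hφ₀ hy h,
      BVPEstimation.Problem.linEst_self hS (hû2 a) _ hy]
    rfl
  have hex : ∀ y : ℝ → Fin l → ℝ, BVPEstimation.IsL2 S.α S.β y →
      ∃ p φ, S.SolvesSystem e₀ e₁ y p φ := fun y hy =>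
    BVPEstimation.Problem.exists_solvesSystem hS h₀ h₁ hy
  refine ⟨fun y hy => ⟨hex y hy, fun p φ p' φ' h h' => h.unique hS h₀ h₁ h'⟩,
    fun F _ φ hφ ξ hξ => BVPEstimation.Problem.ae_isL2_obs hS hξ (hφ.continuousOn hS),
    fun a => ⟨⟨_, _, _, hmin a⟩, fun u₁ u₂ c h y hy p φ hsys => ?_⟩, ?_⟩
  · rw [hval a y hy p φ hsys, (hD a).linEst_of_isMinimax hS hΩ hφ₀ rfl h hy,
      BVPEstimation.Problem.linEst_self hS (hû2 a) _ hy]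
  -- Outside L² the chosen solution is arbitrary, which does not affect the risk because almost
  -- every realization is in L².
  · choose! p φ hsys using hex
    refine ⟨fun y => φ y 1 S.s, fun y hy p' φ' h => ?_, fun a => ?_⟩
    · exact (h.unique hS h₀ h₁ (hsys y hy)).2.2.1 ⟨hS.α_lt_s.le, le_rfl⟩
    · rw [BVPEstimation.Problem.worstRisk_congr hS fun y hy => hval a y hy _ _ (hsys y hy)]
      obtain ⟨m₁, m₂, m₃⟩ := hmin a
      refine le_antisymm (le_iInf fun v₁ => le_iInf fun hv₁ => le_iInf fun v₂ => le_iInf fun hv₂ =>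
        le_iInf fun d => m₃ v₁ v₂ d hv₁ hv₂) ?_
      exact iInf_le_of_le _ <| iInf_le_of_le m₁ <| iInf_le_of_le _ <| iInf_le_of_le m₂ <|
        iInf_le_of_le _ le_rfl
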